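/- Consider the eigenvalue problem $-u''=\lambda u$ on $(-1,1)$, $\lambda\in\mathbb R$, $0\not\equiv u\in C^2[-1,1]$, with the multi-point boundary conditions $$\alpha_0^\pm u(\pm1)+\beta_0^\pm u'(\pm1)=\sum_{i=1}^{m^\pm}\alpha_i^\pm u(\eta_i^\pm)+\sum_{i=1}^{m^\pm}\beta_i^\pm u'(\eta_i^\pm),\tag{BC$^\pm$}$$ where $m^\pm\ge1$, $\eta_i^\pm\in[-1,1]$, $\eta_i^+\ne1$, $\eta_i^-\ne-1$, $\alpha_0^\pm\ge0$, $\alpha_0^\pm+|\beta_0^\pm|>0$, $\pm\beta_0^\pm\ge0$ and, with $A^\pm=\sum_i|\alpha_i^\pm|$ and $B^\pm=\sum_i|\beta_i^\pm|$, $(A^\pm/\alpha_0^\pm)^2+(B^\pm/\beta_0^\pm)^2<1$. Here and below, in a fraction with zero denominator the numerator must also vanish, and the fraction is then omitted. Suppose that $\alpha^-_i=\beta^-_i=0$ for all $i$ (so the condition at $-1$ is the Robin condition $\alpha_0^-u(-1)+\beta_0^-u'(-1)=0$) and that $$\frac{A^+}{\alpha_0^+}+\frac{B^+}{\beta_0^+}<1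 .$$ *Eigenvalues.* Let $\lambda_0<\lambda_1<\cdots$ be the eigenvalues of this problem, and let $\lambda_k^{RD}$ and $\lambda_k^{RN}$ ($k\ge0$) be the eigenvalues, in increasing order, of $-u''=\lambda u$ with the same Robin condition at $-1$ and the condition $u(1)=0$, respectively $u'(1)=0$, at $1$; put $\lambda_{-1}^{RD}:=0$. Let $J^+=(\alpha_0^+/\beta_0^+)^2$ ($J^+=\infty$ if $\beta_0^+=0$), and let $k_c\ge-1$ be the integer with $\lambda_{k_c}^{RD}<J^+\le\lambda_{k_c+1}^{RD}$ ($k_c=-1$ if $J^+=0$). *Nodal sets.* $S_k$ is the set of $u\in C^2[-1,1]$ with $u(\pm1)\ne0$ that have exactly $k$ zeros in $(-1,1)$, all of them simple. $T_k$ is the set of $u\in C^2[-1,1]$ with $u'(\pm1)\ne0$ such that $u'$ has exactly $k$ zeros in $(-1,1)$, all of them simple, and $u$ has a zero strictly between any two consecutive zeros of $u'$. If $\beta_0^-=0$, then in the definition of $S_k$ the requirement $u(-1)\ne0$ is replaced by $u(-1)=0\ne u'(-1)$. If $\alpha_0^-=0$, then in the definition of $T_k$ the requirement $u'(-1)\neq0$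 is replaced by $u'(-1)=0\ne u(-1)$, and the zeros of $u'$ are taken in $[-1,1)$, so that the zero at $-1$ is counted. Suppose in addition that one of the following holds: (a) $\lambda_{k_c}^{RD}<J^+<\lambda_{k_c+1}^{RN}$, and either (i) $\beta_0^+>\lambda^{-1/2}A^++B^+$ for $\lambda=\lambda_{k_c}^{RD}$, or (ii) $\alpha_0^+>A^++\lambda^{1/2}B^+$ for $\lambda=\lambda_{k_c+1}^{RN}$; (b) $\lambda_{k_c+1}^{RN}\le J^+\le\lambda_{k_c+1}^{RD}$. Then: * if $k_c\ge0$, the eigenvalue $\lambda_{k_c}$ exists, every eigenfunction $\psi_{k_c}$ belonging to it is in $T_{k_c+1}$, and $\lambda_{k_c}^{RN}<\lambda_{k_c}<\lambda_{k_c+1}^{RN}$; * the eigenvalue $\lambda_{k_c+1}$ exists, every eigenfunction $\psi_{k_c+1}$ belonging to it is in $S_{k_c+1}$, and $\lambda_{k_c}^{RD}<\lambda_{k_c+1}<\lambda_{k_c+1}^{RD}$, except that if $\alpha_0^-=\alpha_0^+=0$ (in which case $k_c=-1$) the lower bound is replaced by $\lambda_{0}=0$. -/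

import Mathlib

open Set

noncomputable section

namespace MultiPoint

/-- The closed interval `[-1, 1]`. -/
abbrev I : Set ℝ := Icc (-1) 1

/-- The first derivative on `[-1, 1]` (one-sided at the end points). -/
def d1 (u : ℝ → ℝ) : ℝ → ℝ := derivWithin u I

/-- The second derivative on `[-1, 1]` (one-sided at the end points). -/
def d2 (u : ℝ → ℝ) : ℝ → ℝ := derivWithin (d1 u) I

/-- `u` restricts to an element of `C²[-1, 1]`. -/
def IsC2 (u : ℝ → ℝ) : Prop := ContDiffOn ℝ 2 u I

/-! ### Multi-point boundary conditions -/

/-- The coefficients of a multi-point boundary condition at one end point. -/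
structure EndBC where
  m : ℕ
  α₀ : ℝ
  β₀ : ℝ
  α : Fin m → ℝ
  β : Fin m → ℝ
  η : Fin m → ℝ

namespace EndBC

/-- `u` satisfies the multi-point condition with coefficients `B` at the end point `ν = ±1`. -/
def Holds (B : EndBC) (ν : ℝ) (u : ℝ → ℝ) : Prop :=
  B.α₀ * u ν + B.β₀ * d1 u ν = ∑ i, B.α i * u (B.η i) + ∑ i, B.β i * d1 u (B.η i)

/-- `∑ |α_i|` -/
def sumα (B : EndBC) : ℝ := ∑ i, |B.α i|

/-- `∑ |β_i|` -/
def sumβ (B : EndBC) : ℝ := ∑ i, |B.β i|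

/-- If a denominator vanishes then the numerator has to vanish too. The corresponding fraction
is then omitted, which agrees with the value `x / 0 = 0` used below. -/
def NumeratorsOK (B : EndBC) : Prop :=
  (B.α₀ = 0 → B.sumα = 0) ∧ (B.β₀ = 0 → B.sumβ = 0)

/-- `(∑ |α_i| / α₀)² + (∑ |β_i| / β₀)² < 1` -/
def QuadCond (B : EndBC) : Prop :=
  B.NumeratorsOK ∧ (B.sumα / B.α₀) ^ 2 + (B.sumβ / B.β₀) ^ 2 < 1

/-- `∑ |α_i| / α₀ + ∑ |β_i| / β₀ < 1` -/
def LinCond (B : EndBC) : Prop :=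
  B.NumeratorsOK ∧ B.sumα / B.α₀ + B.sumβ / B.β₀ < 1

/-- The standing assumptions on the condition at the end point `ν = ±1`. -/
structure Admissible (B : EndBC) (ν : ℝ) : Prop where
  one_le_m : 1 ≤ B.m
  η_mem : ∀ i, B.η i ∈ I
  η_ne : ∀ i, B.η i ≠ ν
  α₀_nonneg : 0 ≤ B.α₀
  nondegenerate : 0 < B.α₀ + |B.β₀|
  β₀_sign : 0 ≤ ν * B.β₀
  quad : B.QuadCond

/-- The single-point (Robin) condition `α₀ u(ν) + β₀ u'(ν) = 0`, with the same `α₀`, `β₀`. -/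
def singlePoint (B : EndBC) : EndBC := { B with α := 0, β := 0 }

/-- The single-point Dirichlet condition. -/
def dirichlet : EndBC := { m := 1, α₀ := 1, β₀ := 0, α := 0, β := 0, η := 0 }

/-- The single-point Neumann condition. -/
def neumann : EndBC := { m := 1, α₀ := 0, β₀ := 1, α := 0, β := 0, η := 0 }

/-- `α₀ > ∑ |α_i| + λ^{1/2} ∑ |β_i|` -/
def DerivNonzeroCond (B : EndBC) (lam : ℝ) : Prop :=
  B.α₀ > B.sumα + Real.sqrt lam * B.sumβ

/-- `β₀ > λ^{-1/2} ∑ |α_i| + ∑ |β_i|`; when `λ = 0`, the first fraction is subject to the same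
convention as the other fractions (its numerator has to vanish, and it is then omitted). -/
def ValueNonzeroCond (B : EndBC) (lam : ℝ) : Prop :=
  (lam = 0 → B.sumα = 0) ∧ B.β₀ > 1 / Real.sqrt lam * B.sumα + B.sumβ

/-- `J = (α₀ / β₀)²`, with the value `∞` when `β₀ = 0`. -/
def J (B : EndBC) : EReal := if B.β₀ = 0 then ⊤ else (((B.α₀ / B.β₀) ^ 2 : ℝ) : EReal)

end EndBC

/-! ### Eigenvalues and eigenfunctions -/

/-- `u` is a non-trivial `C²[-1, 1]` solution of `-u'' = λ u` on `(-1, 1)` that satisfies the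
boundary conditions with coefficients `Bm` at `-1` and `Bp` at `1`. -/
structure IsEigenfunction (Bm Bp : EndBC) (lam : ℝ) (u : ℝ → ℝ) : Prop where
  c2 : IsC2 u
  nontrivial : ∃ x ∈ I, u x ≠ 0
  eqn : ∀ x ∈ Ioo (-1 : ℝ) 1, -d2 u x = lam * u x
  bc_left : Bm.Holds (-1) u
  bc_right : Bp.Holds 1 u

/-- The set of (real) eigenvalues. -/
def eigenvalues (Bm Bp : EndBC) : Set ℝ := {lam | ∃ u, IsEigenfunction Bm Bp lam u}

/-- `lam` is the eigenvalue `λ_k`: an eigenvalue with exactly `k` eigenvalues below it. -/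
def IsKthEigenvalue (Bm Bp : EndBC) (k : ℕ) (lam : ℝ) : Prop :=
  lam ∈ eigenvalues Bm Bp ∧ (eigenvalues Bm Bp ∩ Iio lam).encard = k

/-- The eigenvalue `λ_k` in the increasing enumeration `λ_0 < λ_1 < ⋯`, with the convention that
`λ_k = 0` for `k < 0`. (At most one number satisfies `IsKthEigenvalue`, and `sInf` selects it.) -/
def eigenvalue (Bm Bp : EndBC) (k : ℤ) : ℝ :=
  if k < 0 then 0 else sInf {lam | IsKthEigenvalue Bm Bp k.toNat lam}

/-- `λ_k^{RD}`: the given Robin condition at `-1`, the Dirichlet condition at `1`. -/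
def eigRD (Bm : EndBC) (k : ℤ) : ℝ := eigenvalue Bm.singlePoint EndBC.dirichlet k

/-- `λ_k^{RN}`: the given Robin condition at `-1`, the Neumann condition at `1`. -/
def eigRN (Bm : EndBC) (k : ℤ) : ℝ := eigenvalue Bm.singlePoint EndBC.neumann k

/-- `kc` is the integer `k_c ≥ -1` with `λ_{k_c}^{RD} < J⁺ ≤ λ_{k_c+1}^{RD}`
(and `k_c = -1` if `J⁺ = 0`). -/
def IsCriticalIndex (Bm Bp : EndBC) (kc : ℤ) : Prop :=
  -1 ≤ kc ∧
    (((eigRD Bm kc : EReal) < Bp.J ∧ Bp.J ≤ (eigRD Bm (kc + 1) : EReal)) ∨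
      (Bp.J = 0 ∧ kc = -1))

/-! ### Nodal sets -/

/-- `f` vanishes at exactly `k` points of `s`, and `f'` vanishes at none of them. -/
def HasSimpleZeros (f : ℝ → ℝ) (s : Set ℝ) (k : ℕ) : Prop :=
  (∀ x ∈ s, f x = 0 → d1 f x ≠ 0) ∧ {x ∈ s | f x = 0}.encard = k

/-- `u` has a zero strictly between any two consecutive zeros of `u'` in `s`. -/
def ZeroBetween (u : ℝ → ℝ) (s : Set ℝ) : Prop :=
  ∀ x ∈ s, ∀ y ∈ s, x < y → d1 u x = 0 → d1 u y = 0 → (∀ z ∈ Ioo x y, d1 u z ≠ 0) →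
    ∃ z ∈ Ioo x y, u z = 0

/-- `S_k⁺` -/
def nodalSPlus (k : ℕ) : Set (ℝ → ℝ) :=
  {u | IsC2 u ∧ 0 < u (-1) ∧ u 1 ≠ 0 ∧ HasSimpleZeros u (Ioo (-1) 1) k}

/-- `T_k⁺` -/
def nodalTPlus (k : ℕ) : Set (ℝ → ℝ) :=
  {u | IsC2 u ∧ 0 < d1 u (-1) ∧ d1 u 1 ≠ 0 ∧ HasSimpleZeros (d1 u) (Ioo (-1) 1) k ∧
    ZeroBetween u (Ioo (-1) 1)}

/-- `S_k⁺`, redefined for the Dirichlet condition `u(-1) = 0`. -/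
def nodalSPlusDirichlet (k : ℕ) : Set (ℝ → ℝ) :=
  {u | IsC2 u ∧ u (-1) = 0 ∧ 0 < d1 u (-1) ∧ u 1 ≠ 0 ∧ HasSimpleZeros u (Ioo (-1) 1) k}

/-- `T_k⁺`, redefined for the Neumann condition `u'(-1) = 0`. The zero of `u'` at `-1`, which for
every Robin condition with `α₀ > 0` lies in the interior, is counted. -/
def nodalTPlusNeumann (k : ℕ) : Set (ℝ → ℝ) :=
  {u | IsC2 u ∧ d1 u (-1) = 0 ∧ 0 < u (-1) ∧ d1 u 1 ≠ 0 ∧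
    HasSimpleZeros (d1 u) (Ico (-1) 1) k ∧ ZeroBetween u (Ico (-1) 1)}

/-- `A ∪ (-A)` -/
def symmetrize (A : Set (ℝ → ℝ)) : Set (ℝ → ℝ) := {u | u ∈ A ∨ -u ∈ A}

open Classical in
/-- `S_k = S_k⁺ ∪ S_k⁻`, redefined if the condition at `-1` is the Dirichlet condition. -/
def nodalS (Bm : EndBC) (k : ℕ) : Set (ℝ → ℝ) :=
  symmetrize (if Bm.β₀ = 0 then nodalSPlusDirichlet k else nodalSPlus k)

open Classical in
/-- `T_k = T_k⁺ ∪ T_k⁻`, redefined if the condition at `-1` is the Neumann condition. -/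
def nodalT (Bm : EndBC) (k : ℕ) : Set (ℝ → ℝ) :=
  symmetrize (if Bm.α₀ = 0 then nodalTPlusNeumann k else nodalTPlus k)

end MultiPoint

end

open Set

noncomputable section

namespace MultiPoint

/-! ### Counting eigenvalues -/

/-! Up to a factor, the Robin condition at -1 leaves one solution for each λ. For λ < 0 it is built
from cosh and sinh with nonnegative coefficients, so it and its derivative are largest at the right
end and the multi-point terms cannot balance the end-point terms. For λ = s² it is r sin(s(x+1) +
θ(s)) with θ(s) in [0, π/2] (`exists_wave_eq`; when s = 0 only if the left condition is Neumann),
and its phase φ(s) = 2s + θ(s) at the right end is strictly increasing. Hence λ_n^{RN} = N_n² and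
λ_n^{RD} = D_n², where φ(N_n) = π/2 + nπ and φ(D_n) = (n+1)π, and the eigenvalues are the squares of
the zeros s ≥ 0 of a continuous function Γ = `charFun`.

At N_n the single-point part of Γ is a positive multiple of ±α₀, at D_n of ±sβ₀, while the
multi-point terms are at most A + sB in the same scale. By the linear condition this is less than
max(α₀, sβ₀), so α₀/β₀, the square root of J⁺, decides which of the two signs is known: at N_0, ...,
N_k and at D_{k+1} for k = k_c. Hypotheses (a) and (b) supply the missing sign at a point e between
D_k and N_{k+1}. For k ≥ 0, the intermediate value theorem then puts a zero between consecutive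
points of N_0, ..., N_k, e, D_{k+1}. For k = -1 the grid is 0, D_0, unless both ends have α₀ = 0 and
the constant solution gives λ_0 = 0.

To identify the indices, Γ must have no zero on [0, N_0] (`charFun_ne_zero_of_phase_le`) and at most
one in every grid interval but the last (`charFun_zero_unique`). In the last interval the least zero
is taken. Uniqueness is the hard step: Γ, divided by its amplitude and by cos φ, has positive
derivative between two supposed zeros, contradicting Rolle. The nodal classes are read off from the
interval of length π that contains φ. -/

theorem IsKthEigenvalue.eq {Bm Bp : EndBC} {k : ℕ} {lam mu : ℝ}
    (h₁ : IsKthEigenvalue Bm Bp k lam) (h₂ : IsKthEigenvalue Bm Bp k mu) : lam = mu := by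
  have key : ∀ {x y : ℝ}, IsKthEigenvalue Bm Bp k x → IsKthEigenvalue Bm Bp k y → ¬ x < y := by
    intro x y hx hy hxy
    have hsub : insert x (eigenvalues Bm Bp ∩ Iio x) ⊆ eigenvalues Bm Bp ∩ Iio y := by
      rintro t (rfl | ⟨ht, htx⟩)
      · exact ⟨hx.1, hxy⟩
      · exact ⟨ht, lt_trans htx hxy⟩
    have h := encard_le_encard hsub
    rw [encard_insert_of_notMem (by simp), hx.2, hy.2] at h
    exact absurd (by exact_mod_cast h : k + 1 ≤ k) (by omega)
  exact le_antisymm (not_lt.1 (key h₂ h₁)) (not_lt.1 (key h₁ h₂))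

theorem IsKthEigenvalue.eigenvalue_eq {Bm Bp : EndBC} {k : ℕ} {lam : ℝ}
    (h : IsKthEigenvalue Bm Bp k lam) : eigenvalue Bm Bp k = lam := by
  have hset : {mu | IsKthEigenvalue Bm Bp k mu} = {lam} := by
    ext mu
    exact ⟨fun hmu => hmu.eq h, fun hmu => by rw [mem_singleton_iff.1 hmu]; exact h⟩
  simp [eigenvalue, hset]

theorem isKthEigenvalue_zero {Bm Bp : EndBC} {lam : ℝ} (h : lam ∈ eigenvalues Bm Bp)
    (hlt : ∀ mu ∈ eigenvalues Bm Bp, lam ≤ mu) : IsKthEigenvalue Bm Bp 0 lam := by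
  refine ⟨h, ?_⟩
  have : eigenvalues Bm Bp ∩ Iio lam = ∅ := by
    ext mu
    simpa using fun hmu => hlt mu hmu
  simp [this]

theorem IsKthEigenvalue.succ {Bm Bp : EndBC} {k : ℕ} {lam mu : ℝ}
    (h : IsKthEigenvalue Bm Bp k lam) (hmu : mu ∈ eigenvalues Bm Bp) (hlt : lam < mu)
    (hgap : ∀ nu ∈ eigenvalues Bm Bp, lam < nu → mu ≤ nu) :
    IsKthEigenvalue Bm Bp (k + 1) mu := by
  refine ⟨hmu, ?_⟩
  have : eigenvalues Bm Bp ∩ Iio mu = insert lam (eigenvalues Bm Bp ∩ Iio lam) := by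
    ext nu
    constructor
    · rintro ⟨h₁, h₂⟩
      rcases lt_trichotomy nu lam with h₃ | h₃ | h₃
      · exact Or.inr ⟨h₁, h₃⟩
      · exact Or.inl h₃
      · exact absurd h₂ (not_lt.2 (hgap nu h₁ h₃))
    · rintro (rfl | ⟨h₁, h₂⟩)
      · exact ⟨h.1, hlt⟩
      · exact ⟨h₁, lt_trans h₂ hlt⟩
  rw [this, encard_insert_of_notMem (by simp), h.2]
  push_cast
  rfl

/-! ### Solutions of the differential equation -/

/-- `C`, `S` solve `-f'' = lam * f` with initial values `(1, 0)` and `(0, 1)` at `0`. -/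
structure FundamentalPair (lam : ℝ) (C S : ℝ → ℝ) : Prop where
  derivC : ∀ z, HasDerivAt C (-lam * S z) z
  derivS : ∀ z, HasDerivAt S (C z) z
  pyth : ∀ z, C z ^ 2 + lam * S z ^ 2 = 1
  C_zero : C 0 = 1
  S_zero : S 0 = 0

theorem mul_mul_sinc (s z : ℝ) : s * (z * Real.sinc (s * z)) = Real.sin (s * z) := by
  by_cases h : s * z = 0
  · rw [h]; rcases mul_eq_zero.1 h with h | h <;> simp [h]
  · rw [Real.sinc_of_ne_zero h, ← mul_assoc, mul_div_cancel₀ _ h]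

/-- Writing sin(sz)/s as z sinc(sz) keeps the family continuous down to s = 0, so that λ = 0 needs
no separate pair. -/
theorem fundamentalPair_trig (s : ℝ) :
    FundamentalPair (s ^ 2) (fun z => Real.cos (s * z)) (fun z => z * Real.sinc (s * z)) := by
  have hS := mul_mul_sinc s
  have hlin : ∀ z : ℝ, HasDerivAt (fun z => s * z) s z := fun z => by
    simpa using (hasDerivAt_id z).const_mul s
  refine ⟨fun z => ?_, fun z => ?_, fun z => ?_, by simp, by simp⟩
  · convert (hlin z).cos using 1
    rw [← hS]; ring
  · by_cases h : s = 0
    · subst h; simpa using hasDerivAt_id' z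
    · have : (fun z => z * Real.sinc (s * z)) = fun z => Real.sin (s * z) / s := by
        ext z; rw [← hS]; field_simp
      rw [this]
      exact ((hlin z).sin.div_const s).congr_deriv (mul_div_cancel_right₀ _ h)
  · have := Real.cos_sq_add_sin_sq (s * z)
    rw [← hS] at this
    linarith [this, mul_pow s (z * Real.sinc (s * z)) 2]

theorem fundamentalPair_hyperbolic {σ : ℝ} (hσ : σ ≠ 0) :
    FundamentalPair (-σ ^ 2) (fun z => Real.cosh (σ * z)) (fun z => Real.sinh (σ * z) / σ) := by
  have hlin : ∀ z : ℝ, HasDerivAt (fun z => σ * z) σ z := fun z => by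
    simpa using (hasDerivAt_id z).const_mul σ
  refine ⟨fun z => ?_, fun z => ?_, fun z => ?_, by simp, by simp⟩
  · convert (hlin z).cosh using 1
    field_simp
  · exact ((hlin z).sinh.div_const σ).congr_deriv (mul_div_cancel_right₀ _ hσ)
  · have := Real.cosh_sq (σ * z)
    field_simp
    linarith

theorem IsC2.hasDerivWithinAt {u : ℝ → ℝ} (h : IsC2 u) {x : ℝ} (hx : x ∈ I) :
    HasDerivWithinAt u (d1 u x) I x :=
  ((h.differentiableOn (by norm_num)) x hx).hasDerivWithinAt

theorem uniqueDiffOn_I : UniqueDiffOn ℝ I := uniqueDiffOn_Icc (by norm_num)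

theorem IsC2.hasDerivWithinAt_d1 {u : ℝ → ℝ} (h : IsC2 u) {x : ℝ} (hx : x ∈ I) :
    HasDerivWithinAt (d1 u) (d2 u x) I x := by
  have h1 : ContDiffOn ℝ 1 (d1 u) I := h.derivWithin uniqueDiffOn_I (by norm_num)
  exact ((h1.differentiableOn (by norm_num)) x hx).hasDerivWithinAt

theorem eq_left_of_hasDerivWithinAt_zero {f f' : ℝ → ℝ}
    (hf : ∀ x ∈ I, HasDerivWithinAt f (f' x) I x) (h0 : ∀ x ∈ Ioo (-1 : ℝ) 1, f' x = 0) :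
    ∀ x ∈ I, f x = f (-1) := by
  intro x hx
  rcases eq_or_lt_of_le hx.1 with h | h
  · rw [← h]
  have hsub : Icc (-1) x ⊆ I := Icc_subset_Icc_right hx.2
  obtain ⟨c, hc, hc'⟩ := exists_hasDerivAt_eq_slope f f' h
    (fun y hy => (hf y (hsub hy)).continuousWithinAt.mono hsub)
    (fun y hy => (hf y (hsub (Ioo_subset_Icc_self hy))).hasDerivAt
      (Icc_mem_nhds hy.1 (lt_of_lt_of_le hy.2 hx.2)))
  rw [h0 c ⟨hc.1, lt_of_lt_of_le hc.2 hx.2⟩, eq_comm, div_eq_zero_iff] at hc'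
  rcases hc' with h' | h' <;> linarith

/-- The combinations uC - u'S and u'C + λuS are constant along a solution. The identity C² + λS² = 1
inverts this system for u and u'. -/
theorem FundamentalPair.solution_eq {lam : ℝ} {C S u : ℝ → ℝ} (hCS : FundamentalPair lam C S)
    (hu : IsC2 u) (heq : ∀ x ∈ Ioo (-1 : ℝ) 1, -d2 u x = lam * u x) :
    ∀ x ∈ I, u x = u (-1) * C (x + 1) + d1 u (-1) * S (x + 1) ∧
      d1 u x = d1 u (-1) * C (x + 1) - lam * u (-1) * S (x + 1) := by
  have hC : ∀ x : ℝ, HasDerivWithinAt (fun x => C (x + 1)) (-lam * S (x + 1)) I x := fun x =>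
    ((hCS.derivC (x + 1)).comp_add_const x 1).hasDerivWithinAt
  have hS : ∀ x : ℝ, HasDerivWithinAt (fun x => S (x + 1)) (C (x + 1)) I x := fun x =>
    ((hCS.derivS (x + 1)).comp_add_const x 1).hasDerivWithinAt
  have hP := eq_left_of_hasDerivWithinAt_zero
    (fun x hx => ((hu.hasDerivWithinAt hx).mul (hC x)).sub
      ((hu.hasDerivWithinAt_d1 hx).mul (hS x)))
    (fun x hx => by linear_combination S (x + 1) * heq x hx)
  have hQ := eq_left_of_hasDerivWithinAt_zero
    (fun x hx => ((hu.hasDerivWithinAt_d1 hx).mul (hC x)).add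
      (((hu.hasDerivWithinAt hx).mul (hS x)).const_mul lam))
    (fun x hx => by linear_combination -C (x + 1) * heq x hx)
  intro x hx
  have h1 := hP x hx
  have h2 := hQ x hx
  have h3 := hCS.pyth (x + 1)
  simp only [Pi.add_apply, Pi.sub_apply, Pi.mul_apply, neg_add_cancel, hCS.C_zero, hCS.S_zero,
    mul_one, mul_zero, sub_zero, add_zero] at h1 h2
  constructor
  · rw [← h1, ← h2]; linear_combination -u x * h3
  · rw [← h1, ← h2]; linear_combination -d1 u x * h3

/-- The solution with fundamental pair `C`, `S` and initial values proportional to those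
prescribed by the Robin condition with coefficients `B` at the left end point. -/
def robin (B : EndBC) (C S : ℝ → ℝ) (z : ℝ) : ℝ := -B.β₀ * C z + B.α₀ * S z

/-- The derivative of `robin`. -/
def robinDeriv (B : EndBC) (lam : ℝ) (C S : ℝ → ℝ) (z : ℝ) : ℝ :=
  B.α₀ * C z + lam * B.β₀ * S z

/-- The defect of `f`, with derivative `f'`, in the multi-point condition at the right end point;
the argument is the distance from the left end point. -/
def EndBC.defect (B : EndBC) (f f' : ℝ → ℝ) : ℝ :=
  B.α₀ * f 2 + B.β₀ * f' 2 - (∑ i, B.α i * f (B.η i + 1) + ∑ i, B.β i * f' (B.η i + 1))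

theorem EndBC.defect_linear (B : EndBC) (c d : ℝ) (f f' g g' : ℝ → ℝ) :
    B.defect (fun z => c * f z + d * g z) (fun z => c * f' z + d * g' z) =
      c * B.defect f f' + d * B.defect g g' := by
  have h1 : ∑ i, B.α i * (c * f (B.η i + 1) + d * g (B.η i + 1)) =
      c * ∑ i, B.α i * f (B.η i + 1) + d * ∑ i, B.α i * g (B.η i + 1) := by
    rw [Finset.mul_sum, Finset.mul_sum, ← Finset.sum_add_distrib]
    exact Finset.sum_congr rfl fun i _ => by ring
  have h2 : ∑ i, B.β i * (c * f' (B.η i + 1) + d * g' (B.η i + 1)) =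
      c * ∑ i, B.β i * f' (B.η i + 1) + d * ∑ i, B.β i * g' (B.η i + 1) := by
    rw [Finset.mul_sum, Finset.mul_sum, ← Finset.sum_add_distrib]
    exact Finset.sum_congr rfl fun i _ => by ring
  simp only [EndBC.defect, h1, h2]
  ring

theorem EndBC.defect_const_mul (B : EndBC) (c : ℝ) (f f' : ℝ → ℝ) :
    B.defect (fun z => c * f z) (fun z => c * f' z) = c * B.defect f f' := by
  simpa using B.defect_linear c 0 f f' f f'

theorem EndBC.sumα_nonneg (B : EndBC) : 0 ≤ B.sumα := Finset.sum_nonneg fun _ _ => abs_nonneg _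

theorem EndBC.sumβ_nonneg (B : EndBC) : 0 ≤ B.sumβ := Finset.sum_nonneg fun _ _ => abs_nonneg _

theorem EndBC.abs_sum_le (B : EndBC) {M M' : ℝ} {x y : Fin B.m → ℝ}
    (hx : ∀ i, |x i| ≤ M) (hy : ∀ i, |y i| ≤ M') :
    |∑ i, B.α i * x i + ∑ i, B.β i * y i| ≤ B.sumα * M + B.sumβ * M' := by
  refine (abs_add_le _ _).trans (add_le_add ?_ ?_)
  · refine (Finset.abs_sum_le_sum_abs _ _).trans ?_
    rw [EndBC.sumα, Finset.sum_mul]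
    exact Finset.sum_le_sum fun i _ => by
      rw [abs_mul]; exact mul_le_mul_of_nonneg_left (hx i) (abs_nonneg _)
  · refine (Finset.abs_sum_le_sum_abs _ _).trans ?_
    rw [EndBC.sumβ, Finset.sum_mul]
    exact Finset.sum_le_sum fun i _ => by
      rw [abs_mul]; exact mul_le_mul_of_nonneg_left (hy i) (abs_nonneg _)

/-- Separate bounds for f and f' matter: in the applications M is the end value f 2 itself, while M'
may be a cruder bound. -/
theorem EndBC.defect_pos {B : EndBC} (hB : ∀ i, B.η i ∈ I) {f f' : ℝ → ℝ} {M M' : ℝ}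
    (hf : ∀ z ∈ Icc (0 : ℝ) 2, |f z| ≤ M) (hf' : ∀ z ∈ Icc (0 : ℝ) 2, |f' z| ≤ M')
    (h : B.sumα * M + B.sumβ * M' < B.α₀ * f 2 + B.β₀ * f' 2) : 0 < B.defect f f' := by
  have hmem : ∀ i, B.η i + 1 ∈ Icc (0 : ℝ) 2 := fun i =>
    ⟨by linarith [(hB i).1], by linarith [(hB i).2]⟩
  have := B.abs_sum_le (fun i => hf _ (hmem i)) (fun i => hf' _ (hmem i))
  have := le_abs_self
    (∑ i, B.α i * f (B.η i + 1) + ∑ i, B.β i * f' (B.η i + 1))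
  unfold EndBC.defect
  linarith

theorem d1_congr {u v : ℝ → ℝ} (h : EqOn u v I) : EqOn (d1 u) (d1 v) I := fun _ hx =>
  derivWithin_congr h (h hx)

theorem d1_eq_of_hasDerivAt {u : ℝ → ℝ} {u' x : ℝ} (hx : x ∈ I) (h : HasDerivAt u u' x) :
    d1 u x = u' := h.hasDerivWithinAt.derivWithin (uniqueDiffOn_I x hx)

section Robin

variable {lam : ℝ} {C S : ℝ → ℝ}

theorem FundamentalPair.hasDerivAt_robin (h : FundamentalPair lam C S) (B : EndBC) (z : ℝ) :
    HasDerivAt (robin B C S) (robinDeriv B lam C S z) z := by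
  refine (((h.derivC z).const_mul (-B.β₀)).add ((h.derivS z).const_mul B.α₀)).congr_deriv ?_
  unfold robinDeriv
  ring

theorem FundamentalPair.hasDerivAt_robinDeriv (h : FundamentalPair lam C S) (B : EndBC) (z : ℝ) :
    HasDerivAt (robinDeriv B lam C S) (-lam * robin B C S z) z := by
  refine (((h.derivC z).const_mul B.α₀).add
    ((h.derivS z).const_mul (lam * B.β₀))).congr_deriv ?_
  unfold robin
  ring

theorem EndBC.holds_one_iff (B : EndBC) (hB : ∀ i, B.η i ∈ I) {f f' u : ℝ → ℝ}
    (hu : ∀ x ∈ I, u x = f (x + 1) ∧ d1 u x = f' (x + 1)) :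
    B.Holds 1 u ↔ B.defect f f' = 0 := by
  have h1 := hu 1 (by norm_num)
  norm_num at h1
  have hs : ∑ i, B.α i * u (B.η i) = ∑ i, B.α i * f (B.η i + 1) :=
    Finset.sum_congr rfl fun i _ => by rw [(hu _ (hB i)).1]
  have hs' : ∑ i, B.β i * d1 u (B.η i) = ∑ i, B.β i * f' (B.η i + 1) :=
    Finset.sum_congr rfl fun i _ => by rw [(hu _ (hB i)).2]
  rw [EndBC.Holds, EndBC.defect, h1.1, h1.2, hs, hs', sub_eq_zero]

theorem EndBC.holds_left_iff {B : EndBC} (hα : B.α = 0) (hβ : B.β = 0) (u : ℝ → ℝ) :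
    B.Holds (-1) u ↔ B.α₀ * u (-1) + B.β₀ * d1 u (-1) = 0 := by
  simp [EndBC.Holds, hα, hβ]

theorem EndBC.Admissible.sq_add_sq_pos {B : EndBC} {ν : ℝ} (hB : B.Admissible ν) :
    0 < B.α₀ ^ 2 + B.β₀ ^ 2 := by
  by_contra hn
  have h1 : B.α₀ = 0 := by nlinarith [sq_nonneg B.α₀, sq_nonneg B.β₀]
  have h2 : B.β₀ = 0 := by nlinarith [sq_nonneg B.α₀, sq_nonneg B.β₀]
  have := hB.nondegenerate
  simp [h1, h2] at this

theorem IsEigenfunction.eq_robin {Bm Bp : EndBC} {u : ℝ → ℝ} (hBm : Bm.Admissible (-1))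
    (hα : Bm.α = 0) (hβ : Bm.β = 0) (h : FundamentalPair lam C S)
    (hu : IsEigenfunction Bm Bp lam u) :
    ∃ c ≠ 0, ∀ x ∈ I, u x = c * robin Bm C S (x + 1) ∧
      d1 u x = c * robinDeriv Bm lam C S (x + 1) := by
  have hd := hBm.sq_add_sq_pos
  have hbc := (EndBC.holds_left_iff hα hβ u).1 hu.bc_left
  -- The initial vector (u, u') at -1 is orthogonal to (α₀, β₀), hence a multiple of (-β₀, α₀); c is
  -- the projection coefficient.
  set c := (-Bm.β₀ * u (-1) + Bm.α₀ * d1 u (-1)) / (Bm.α₀ ^ 2 + Bm.β₀ ^ 2) with hc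
  have h1 : u (-1) = c * -Bm.β₀ := by
    rw [hc]; field_simp; linear_combination Bm.α₀ * hbc
  have h2 : d1 u (-1) = c * Bm.α₀ := by
    rw [hc]; field_simp; linear_combination Bm.β₀ * hbc
  have key : ∀ x ∈ I, u x = c * robin Bm C S (x + 1) ∧
      d1 u x = c * robinDeriv Bm lam C S (x + 1) := by
    intro x hx
    obtain ⟨h3, h4⟩ := h.solution_eq hu.c2 hu.eqn x hx
    rw [h3, h4, h1, h2]
    unfold robin robinDeriv
    constructor <;> ring
  refine ⟨c, fun h0 => ?_, key⟩
  obtain ⟨x, hx, hx0⟩ := hu.nontrivial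
  exact hx0 (by rw [(key x hx).1, h0, zero_mul])

theorem mem_eigenvalues_iff {Bm Bp : EndBC} (hBm : Bm.Admissible (-1))
    (hα : Bm.α = 0) (hβ : Bm.β = 0) (hη : ∀ i, Bp.η i ∈ I) (h : FundamentalPair lam C S) :
    lam ∈ eigenvalues Bm Bp ↔ Bp.defect (robin Bm C S) (robinDeriv Bm lam C S) = 0 := by
  constructor
  · rintro ⟨u, hu⟩
    obtain ⟨c, hc, hcu⟩ := hu.eq_robin hBm hα hβ h
    have := (Bp.holds_one_iff hη (f := fun z => c * robin Bm C S z)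
      (f' := fun z => c * robinDeriv Bm lam C S z) hcu).1 hu.bc_right
    rw [EndBC.defect_const_mul Bp c (robin Bm C S) (robinDeriv Bm lam C S)] at this
    exact (mul_eq_zero.1 this).resolve_left hc
  · intro h0
    have hd : ∀ x : ℝ, HasDerivAt (fun x => robin Bm C S (x + 1))
        (robinDeriv Bm lam C S (x + 1)) x := fun x =>
      (h.hasDerivAt_robin Bm (x + 1)).comp_add_const x 1
    have hd' : ∀ x : ℝ, HasDerivAt (fun x => robinDeriv Bm lam C S (x + 1))
        (-lam * robin Bm C S (x + 1)) x := fun x =>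
      (h.hasDerivAt_robinDeriv Bm (x + 1)).comp_add_const x 1
    have hd1 : EqOn (d1 fun x => robin Bm C S (x + 1)) (fun x => robinDeriv Bm lam C S (x + 1)) I :=
      fun x hx => d1_eq_of_hasDerivAt hx (hd x)
    have hw0 : robin Bm C S 0 = -Bm.β₀ := by simp [robin, h.C_zero, h.S_zero]
    have hw0' : robinDeriv Bm lam C S 0 = Bm.α₀ := by simp [robinDeriv, h.C_zero, h.S_zero]
    have hleft := hd1 (show (-1 : ℝ) ∈ I by norm_num)
    simp only [neg_add_cancel, hw0'] at hleft
    refine ⟨fun x => robin Bm C S (x + 1), ?_, ?_, ?_, ?_, ?_⟩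
    · have e1 : deriv (fun x => robin Bm C S (x + 1)) = fun x => robinDeriv Bm lam C S (x + 1) :=
        funext fun x => (hd x).deriv
      have e2 : deriv (fun x => robinDeriv Bm lam C S (x + 1)) =
          fun x => -lam * robin Bm C S (x + 1) := funext fun x => (hd' x).deriv
      have c2 : ContDiff ℝ 2 fun x => robin Bm C S (x + 1) := by
        rw [show (2 : WithTop ℕ∞) = 1 + 1 by norm_num, contDiff_succ_iff_deriv]
        refine ⟨fun x => (hd x).differentiableAt, by simp, ?_⟩
        rw [e1, contDiff_one_iff_deriv]
        refine ⟨fun x => (hd' x).differentiableAt, ?_⟩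
        rw [e2]
        exact continuous_const.mul (continuous_iff_continuousAt.2 fun x => (hd x).continuousAt)
      exact c2.contDiffOn
    · by_contra hn
      push Not at hn
      have e0 := hn (-1) (by norm_num)
      simp only [neg_add_cancel, hw0] at e0
      have hz : EqOn (fun x => robin Bm C S (x + 1)) (fun _ => 0) I := fun x hx => hn x hx
      have e1 := d1_congr hz (show (-1 : ℝ) ∈ I by norm_num)
      rw [hleft, d1_eq_of_hasDerivAt (by norm_num) (hasDerivAt_const (-1 : ℝ) (0 : ℝ))] at e1
      have := hBm.sq_add_sq_pos
      nlinarith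
    · intro x hx
      have hx' := Ioo_subset_Icc_self hx
      have : d2 (fun x => robin Bm C S (x + 1)) x = -lam * robin Bm C S (x + 1) :=
        (d1_congr hd1 hx').trans (d1_eq_of_hasDerivAt hx' (hd' x))
      rw [this]; ring
    · rw [EndBC.holds_left_iff hα hβ, hleft, neg_add_cancel, hw0]
      ring
    · exact (Bp.holds_one_iff hη fun x hx => ⟨rfl, hd1 hx⟩).2 h0

end Robin

/-- The assumptions on the condition at the right end point which are common to the multi-point
condition, the Dirichlet condition and the Neumann condition. -/
structure EndBC.Regular (B : EndBC) : Prop where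
  η_mem : ∀ i, B.η i ∈ I
  α₀_nonneg : 0 ≤ B.α₀
  β₀_nonneg : 0 ≤ B.β₀
  pos : 0 < B.α₀ + B.β₀
  lin : B.LinCond

theorem EndBC.Admissible.regular {B : EndBC} (h : B.Admissible 1) (hlin : B.LinCond) :
    B.Regular := by
  have hβ : 0 ≤ B.β₀ := by simpa using h.β₀_sign
  refine ⟨h.η_mem, h.α₀_nonneg, hβ, ?_, hlin⟩
  simpa [abs_of_nonneg hβ] using h.nondegenerate

theorem EndBC.dirichlet_regular : EndBC.dirichlet.Regular := by
  have hη : ∀ i, EndBC.dirichlet.η i = 0 := fun _ => rfl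
  have hα : ∀ i, EndBC.dirichlet.α i = 0 := fun _ => rfl
  have hβ : ∀ i, EndBC.dirichlet.β i = 0 := fun _ => rfl
  have hA : EndBC.dirichlet.sumα = 0 := by simp [EndBC.sumα, hα]
  have hB : EndBC.dirichlet.sumβ = 0 := by simp [EndBC.sumβ, hβ]
  refine ⟨fun i => ?_, ?_, ?_, ?_, ?_⟩
  · simp [hη]
  · norm_num [EndBC.dirichlet]
  · norm_num [EndBC.dirichlet]
  · norm_num [EndBC.dirichlet]
  · simp [EndBC.LinCond, EndBC.NumeratorsOK, hA, hB]

theorem EndBC.neumann_regular : EndBC.neumann.Regular := by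
  have hη : ∀ i, EndBC.neumann.η i = 0 := fun _ => rfl
  have hα : ∀ i, EndBC.neumann.α i = 0 := fun _ => rfl
  have hβ : ∀ i, EndBC.neumann.β i = 0 := fun _ => rfl
  have hA : EndBC.neumann.sumα = 0 := by simp [EndBC.sumα, hα]
  have hB : EndBC.neumann.sumβ = 0 := by simp [EndBC.sumβ, hβ]
  refine ⟨fun i => ?_, ?_, ?_, ?_, ?_⟩
  · simp [hη]
  · norm_num [EndBC.neumann]
  · norm_num [EndBC.neumann]
  · norm_num [EndBC.neumann]
  · simp [EndBC.LinCond, EndBC.NumeratorsOK, hA, hB]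

theorem EndBC.dirichlet_defect (f f' : ℝ → ℝ) : EndBC.dirichlet.defect f f' = f 2 := by
  simp [EndBC.dirichlet, EndBC.defect]

theorem EndBC.neumann_defect (f f' : ℝ → ℝ) : EndBC.neumann.defect f f' = f' 2 := by
  simp [EndBC.neumann, EndBC.defect]

theorem EndBC.singlePoint_eq {B : EndBC} (hα : B.α = 0) (hβ : B.β = 0) : B.singlePoint = B := by
  cases B
  simp only at hα hβ
  simp [EndBC.singlePoint, hα, hβ]

/-- The fractions in multiplied-out form: the products remain correct for a zero denominator,
because the numerator then vanishes as well. -/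
theorem EndBC.Regular.exists_ratios {B : EndBC} (h : B.Regular) :
    ∃ p q : ℝ, 0 ≤ p ∧ 0 ≤ q ∧ p + q < 1 ∧ B.sumα = p * B.α₀ ∧ B.sumβ = q * B.β₀ := by
  refine ⟨B.sumα / B.α₀, B.sumβ / B.β₀, div_nonneg B.sumα_nonneg h.α₀_nonneg,
    div_nonneg B.sumβ_nonneg h.β₀_nonneg, h.lin.2, ?_, ?_⟩
  · by_cases h0 : B.α₀ = 0
    · simp [h0, h.lin.1.1 h0]
    · field_simp
  · by_cases h0 : B.β₀ = 0
    · simp [h0, h.lin.1.2 h0]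
    · field_simp

/-- If `B` is regular, the multi-point terms are dominated whenever the larger one of the two
single-point bounds is. -/
theorem EndBC.Regular.weighted_lt {B : EndBC} (h : B.Regular) {x y t : ℝ}
    (ht : 0 < t) (hx : B.α₀ * x ≤ t) (hy : B.β₀ * y ≤ t) : B.sumα * x + B.sumβ * y < t := by
  obtain ⟨p, q, hp, hq, hpq, hA, hB⟩ := h.exists_ratios
  rw [hA, hB]
  have h1 := mul_le_mul_of_nonneg_left hx hp
  have h2 := mul_le_mul_of_nonneg_left hy hq
  nlinarith

theorem EndBC.Admissible.left_pos {B : EndBC} (h : B.Admissible (-1)) :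
    0 ≤ B.α₀ ∧ 0 ≤ -B.β₀ ∧ 0 < B.α₀ + -B.β₀ := by
  have hβ : 0 ≤ -B.β₀ := by simpa using h.β₀_sign
  refine ⟨h.α₀_nonneg, hβ, ?_⟩
  have := h.nondegenerate
  rwa [abs_of_nonpos (by linarith)] at this

/-- Since α₀ and -β₀ are nonnegative at the left end, the hyperbolic solution and its derivative are
nonnegative and nondecreasing, so both attain their maxima at the right end and the defect is
positive. -/
theorem not_mem_eigenvalues_of_neg {Bm Bp : EndBC} (hBm : Bm.Admissible (-1))
    (hα : Bm.α = 0) (hβ : Bm.β = 0) (hBp : Bp.Regular) {lam : ℝ} (hlam : lam < 0) :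
    lam ∉ eigenvalues Bm Bp := by
  obtain ⟨σ, hσ, rfl⟩ : ∃ σ : ℝ, 0 < σ ∧ lam = -σ ^ 2 :=
    ⟨√(-lam), Real.sqrt_pos.2 (by linarith), by rw [Real.sq_sqrt (by linarith)]; ring⟩
  rw [mem_eigenvalues_iff hBm hα hβ hBp.η_mem (fundamentalPair_hyperbolic hσ.ne')]
  obtain ⟨ha, hb, hab⟩ := hBm.left_pos
  set a := Bm.α₀
  set b := -Bm.β₀ with hbdef
  have hb' : Bm.β₀ = -b := by rw [hbdef, neg_neg]
  have hw : robin Bm (fun z => Real.cosh (σ * z)) (fun z => Real.sinh (σ * z) / σ) =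
      fun z => b * Real.cosh (σ * z) + a * (Real.sinh (σ * z) / σ) := rfl
  have hw' : robinDeriv Bm (-σ ^ 2) (fun z => Real.cosh (σ * z))
      (fun z => Real.sinh (σ * z) / σ) =
      fun z => a * Real.cosh (σ * z) + b * σ * Real.sinh (σ * z) := by
    funext z
    simp only [robinDeriv, hb']
    field_simp
    ring
  rw [hw, hw']
  have hsinh : ∀ z ∈ Icc (0 : ℝ) 2,
      0 ≤ Real.sinh (σ * z) ∧ Real.sinh (σ * z) ≤ Real.sinh (σ * 2) := fun z hz =>
    ⟨Real.sinh_nonneg_iff.2 (mul_nonneg hσ.le hz.1),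
      Real.sinh_le_sinh.2 (mul_le_mul_of_nonneg_left hz.2 hσ.le)⟩
  have hcosh : ∀ z ∈ Icc (0 : ℝ) 2,
      0 < Real.cosh (σ * z) ∧ Real.cosh (σ * z) ≤ Real.cosh (σ * 2) := fun z hz => by
    refine ⟨Real.cosh_pos _, Real.cosh_le_cosh.2 ?_⟩
    rw [abs_of_nonneg (mul_nonneg hσ.le hz.1), abs_of_nonneg (by positivity)]
    exact mul_le_mul_of_nonneg_left hz.2 hσ.le
  have hsp : 0 < Real.sinh (σ * 2) := Real.sinh_pos_iff.2 (by positivity)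
  have hcp := Real.cosh_pos (σ * 2)
  refine (EndBC.defect_pos hBp.η_mem (M := b * Real.cosh (σ * 2) + a * (Real.sinh (σ * 2) / σ))
    (M' := a * Real.cosh (σ * 2) + b * σ * Real.sinh (σ * 2)) ?_ ?_ ?_).ne'
  · intro z hz
    obtain ⟨h1, h2⟩ := hsinh z hz
    obtain ⟨h3, h4⟩ := hcosh z hz
    rw [abs_of_nonneg (by positivity)]
    gcongr
  · intro z hz
    obtain ⟨h1, h2⟩ := hsinh z hz
    obtain ⟨h3, h4⟩ := hcosh z hz
    rw [abs_of_nonneg (by positivity)]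
    gcongr
  · have hM : 0 < b * Real.cosh (σ * 2) + a * (Real.sinh (σ * 2) / σ) := by
      rcases ha.eq_or_lt with h | h
      · have : 0 < b := by linarith
        positivity
      · positivity
    have hM' : 0 < a * Real.cosh (σ * 2) + b * σ * Real.sinh (σ * 2) := by
      rcases ha.eq_or_lt with h | h
      · have : 0 < b := by linarith
        positivity
      · positivity
    have h1 := mul_nonneg hBp.α₀_nonneg hM.le
    have h2 := mul_nonneg hBp.β₀_nonneg hM'.le
    refine hBp.weighted_lt ?_ (by linarith) (by linarith)
    rcases hBp.α₀_nonneg.eq_or_lt with h | h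
    · have := mul_pos (show 0 < Bp.β₀ by linarith [hBp.pos]) hM'
      linarith
    · have := mul_pos h hM
      linarith

/-- The solution of `-f'' = s² f` that satisfies the condition at the left end point. -/
def wave (B : EndBC) (s z : ℝ) : ℝ :=
  robin B (fun z => Real.cos (s * z)) (fun z => z * Real.sinc (s * z)) z

/-- The derivative of `wave`. -/
def waveDeriv (B : EndBC) (s z : ℝ) : ℝ :=
  robinDeriv B (s ^ 2) (fun z => Real.cos (s * z)) (fun z => z * Real.sinc (s * z)) z

/-- The characteristic function: the eigenvalues are the squares of its zeros. -/
def charFun (Bm Bp : EndBC) (s : ℝ) : ℝ := Bp.defect (wave Bm s) (waveDeriv Bm s)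

theorem sq_mem_eigenvalues_iff {Bm Bp : EndBC} (hBm : Bm.Admissible (-1))
    (hα : Bm.α = 0) (hβ : Bm.β = 0) (hBp : Bp.Regular) (s : ℝ) :
    s ^ 2 ∈ eigenvalues Bm Bp ↔ charFun Bm Bp s = 0 :=
  mem_eigenvalues_iff hBm hα hβ hBp.η_mem (fundamentalPair_trig s)

theorem exists_sq_of_mem_eigenvalues {Bm Bp : EndBC} (hBm : Bm.Admissible (-1))
    (hα : Bm.α = 0) (hβ : Bm.β = 0) (hBp : Bp.Regular) {lam : ℝ} (h : lam ∈ eigenvalues Bm Bp) :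
    ∃ s, 0 ≤ s ∧ lam = s ^ 2 ∧ charFun Bm Bp s = 0 := by
  have h0 : 0 ≤ lam := not_lt.1 fun hn => not_mem_eigenvalues_of_neg hBm hα hβ hBp hn h
  refine ⟨√lam, Real.sqrt_nonneg _, (Real.sq_sqrt h0).symm, ?_⟩
  rw [← sq_mem_eigenvalues_iff hBm hα hβ hBp, Real.sq_sqrt h0]
  exact h

theorem IsEigenfunction.eq_wave {Bm Bp : EndBC} {u : ℝ → ℝ} {s : ℝ} (hBm : Bm.Admissible (-1))
    (hα : Bm.α = 0) (hβ : Bm.β = 0) (hu : IsEigenfunction Bm Bp (s ^ 2) u) :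
    ∃ c ≠ 0, ∀ x ∈ I, u x = c * wave Bm s (x + 1) ∧ d1 u x = c * waveDeriv Bm s (x + 1) :=
  hu.eq_robin hBm hα hβ (fundamentalPair_trig s)

theorem continuous_charFun (Bm Bp : EndBC) : Continuous (charFun Bm Bp) := by
  have hsinc := Real.continuous_sinc
  unfold charFun EndBC.defect wave waveDeriv robin robinDeriv
  fun_prop

/-- At s = 0 the solution is affine, nonnegative and nondecreasing. The excluded case α₀ = 0 at both
ends is the one where a constant solves the problem. -/
theorem charFun_zero_pos {Bm Bp : EndBC} (hBm : Bm.Admissible (-1)) (hBp : Bp.Regular)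
    (h : 0 < Bm.α₀ + Bp.α₀) : 0 < charFun Bm Bp 0 := by
  obtain ⟨ha, hb, hab⟩ := hBm.left_pos
  have hw : wave Bm 0 = fun z => -Bm.β₀ + Bm.α₀ * z := by
    funext z; simp [wave, robin]
  have hw' : waveDeriv Bm 0 = fun z => Bm.α₀ := by
    funext z; simp [waveDeriv, robinDeriv]
  rw [charFun, hw, hw']
  refine EndBC.defect_pos hBp.η_mem (M := -Bm.β₀ + Bm.α₀ * 2) (M' := Bm.α₀) ?_ ?_ ?_
  · intro z hz
    rw [abs_of_nonneg (by have := hz.1; positivity)]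
    have := hz.2
    gcongr
  · intro z hz
    rw [abs_of_nonneg ha]
  · have h1 := mul_nonneg hBp.α₀_nonneg (show 0 ≤ -Bm.β₀ + Bm.α₀ * 2 by linarith)
    have h2 := mul_nonneg hBp.β₀_nonneg ha
    refine hBp.weighted_lt ?_ (by linarith) (by linarith)
    rcases hBp.α₀_nonneg.eq_or_lt with h' | h'
    · have := mul_pos (show 0 < Bp.β₀ by linarith [hBp.pos]) (show 0 < Bm.α₀ by linarith)
      linarith
    · have := mul_pos h' (show 0 < -Bm.β₀ + Bm.α₀ * 2 by linarith)
      linarith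

/-! ### The phase -/

/-- The phase of `wave` at the left end point. -/
def angle (B : EndBC) (s : ℝ) : ℝ :=
  if B.α₀ = 0 then Real.pi / 2 else Real.arctan (s * (-B.β₀ / B.α₀))

/-- The phase of `wave` at the right end point. -/
def phase (B : EndBC) (s : ℝ) : ℝ := s * 2 + angle B s

theorem angle_mem {B : EndBC} (hB : B.Admissible (-1)) {s : ℝ} (hs : 0 ≤ s) :
    angle B s ∈ Icc 0 (Real.pi / 2) := by
  obtain ⟨ha, hb, -⟩ := hB.left_pos
  unfold angle
  split_ifs
  · exact ⟨by positivity, le_rfl⟩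
  · exact ⟨Real.arctan_nonneg.2 (by positivity), (Real.arctan_lt_pi_div_two _).le⟩

theorem continuous_angle (B : EndBC) : Continuous (angle B) := by
  unfold angle
  split_ifs
  · exact continuous_const
  · exact Real.continuous_arctan.comp (by fun_prop)

theorem continuous_phase (B : EndBC) : Continuous (phase B) := by
  have := continuous_angle B
  unfold phase
  fun_prop

theorem angle_mono {B : EndBC} (hB : B.Admissible (-1)) : Monotone (angle B) := by
  obtain ⟨ha, hb, -⟩ := hB.left_pos
  intro s t hst
  unfold angle
  split_ifs
  · exact le_rfl
  · exact Real.arctan_mono (mul_le_mul_of_nonneg_right hst (by positivity))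

theorem phase_strictMono {B : EndBC} (hB : B.Admissible (-1)) : StrictMono (phase B) :=
  fun s t hst => add_lt_add_of_lt_of_le (by linarith) (angle_mono hB hst.le)

theorem exists_phase_eq {B : EndBC} (hB : B.Admissible (-1)) {y : ℝ} (hy : angle B 0 ≤ y) :
    ∃ s, 0 ≤ s ∧ phase B s = y := by
  have h0 : 0 ≤ y := le_trans (angle_mem hB le_rfl).1 hy
  have := intermediate_value_Icc h0 (continuous_phase B).continuousOn
  obtain ⟨s, hs, hs'⟩ := this ⟨by simpa [phase] using hy, by
    have := (angle_mem hB h0).1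
    unfold phase
    linarith⟩
  exact ⟨s, hs.1, hs'⟩

/-- With tan θ = st for a constant t, θ' = t cos²θ = sin θ cos θ / s. The last form also covers the
constant angle π/2. -/
theorem hasDerivAt_angle {B : EndBC} {s : ℝ} (hs : 0 < s) :
    HasDerivAt (angle B) (Real.sin (angle B s) * Real.cos (angle B s) / s) s := by
  by_cases h : B.α₀ = 0
  · have : angle B = fun _ => Real.pi / 2 := by funext t; simp [angle, h]
    rw [this]
    simpa using hasDerivAt_const s (Real.pi / 2)
  · have : angle B = fun t => Real.arctan (t * (-B.β₀ / B.α₀)) := by funext t; simp [angle, h]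
    rw [this]
    refine ((hasDerivAt_mul_const (-B.β₀ / B.α₀)).arctan).congr_deriv ?_
    set t := -B.β₀ / B.α₀
    have hc := Real.cos_arctan_pos (s * t)
    have h1 := Real.tan_arctan (s * t)
    rw [Real.tan_eq_sin_div_cos, div_eq_iff hc.ne'] at h1
    have h2 := Real.cos_sq_arctan (s * t)
    dsimp only
    rw [h1, ← h2]
    field_simp

/-- At s = 0 the sine form survives only for the left Neumann condition, where the solution is
constant; otherwise it is affine and nonconstant. -/
theorem exists_wave_eq {B : EndBC} (hB : B.Admissible (-1)) {s : ℝ}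
    (hs : 0 < s ∨ s = 0 ∧ B.α₀ = 0) :
    ∃ r > 0, ∀ z, wave B s z = r * Real.sin (s * z + angle B s) ∧
      waveDeriv B s z = r * (s * Real.cos (s * z + angle B s)) := by
  obtain ⟨ha, hb, hab⟩ := hB.left_pos
  have hS := mul_mul_sinc s
  by_cases h : B.α₀ = 0
  · refine ⟨-B.β₀, by linarith, fun z => ?_⟩
    simp only [wave, waveDeriv, robin, robinDeriv, angle, h, if_true, Real.sin_add_pi_div_two,
      Real.cos_add_pi_div_two, ← hS]
    constructor <;> ring
  · have hs : 0 < s := hs.resolve_right fun h' => h h'.2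
    have ha : 0 < B.α₀ := lt_of_le_of_ne ha (Ne.symm h)
    have hc := Real.cos_arctan_pos (s * (-B.β₀ / B.α₀))
    have h1 := Real.tan_arctan (s * (-B.β₀ / B.α₀))
    rw [Real.tan_eq_sin_div_cos, div_eq_iff hc.ne'] at h1
    -- The amplitude is forced at z = 0, where the derivative α₀ must equal r s cos θ.
    refine ⟨B.α₀ / s / Real.cos (Real.arctan (s * (-B.β₀ / B.α₀))), by positivity, fun z => ?_⟩
    simp only [wave, waveDeriv, robin, robinDeriv, angle, h, if_false, Real.sin_add, Real.cos_add,
      h1, ← hS]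
    constructor
    · field_simp
      ring
    · field_simp
      ring

/-- The characteristic function for the solution with amplitude `1`. -/
def trigFun (Bm Bp : EndBC) (s : ℝ) : ℝ :=
  Bp.defect (fun z => Real.sin (s * z + angle Bm s)) (fun z => s * Real.cos (s * z + angle Bm s))

theorem pos_or_of_phase_pos {B : EndBC} {s : ℝ} (hs : 0 ≤ s) (h : 0 < phase B s) :
    0 < s ∨ s = 0 ∧ B.α₀ = 0 := by
  rcases hs.eq_or_lt with h0 | h0
  · refine Or.inr ⟨h0.symm, by_contra fun ha => ?_⟩
    simp [← h0, phase, angle, ha] at h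
  · exact Or.inl h0

theorem phase_pos {B : EndBC} (hB : B.Admissible (-1)) {s : ℝ} (hs : 0 < s) : 0 < phase B s := by
  have := (angle_mem hB hs.le).1
  unfold phase
  linarith

theorem exists_charFun_eq {Bm : EndBC} (hBm : Bm.Admissible (-1)) (Bp : EndBC) {s : ℝ}
    (hs : 0 ≤ s) (h : 0 < phase Bm s) :
    ∃ r > 0, charFun Bm Bp s = r * trigFun Bm Bp s := by
  obtain ⟨r, hr, hw⟩ := exists_wave_eq hBm (pos_or_of_phase_pos hs h)
  refine ⟨r, hr, ?_⟩
  rw [charFun, trigFun, ← EndBC.defect_const_mul]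
  congr 1
  · funext z; exact (hw z).1
  · funext z; exact (hw z).2

theorem abs_trigFun_sub_le (Bm Bp : EndBC) {s : ℝ} (hs : 0 ≤ s) :
    |Bp.α₀ * Real.sin (phase Bm s) + Bp.β₀ * (s * Real.cos (phase Bm s)) - trigFun Bm Bp s| ≤
      Bp.sumα + s * Bp.sumβ := by
  have := Bp.abs_sum_le (M := 1) (M' := s)
    (x := fun i => Real.sin (s * (Bp.η i + 1) + angle Bm s))
    (y := fun i => s * Real.cos (s * (Bp.η i + 1) + angle Bm s))
    (fun i => Real.abs_sin_le_one _) (fun i => by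
      rw [abs_mul, abs_of_nonneg hs]
      exact mul_le_of_le_one_right hs (Real.abs_cos_le_one _))
  rw [mul_one, mul_comm Bp.sumβ] at this
  simpa only [trigFun, EndBC.defect, phase, sub_sub_cancel] using this

theorem neg_one_pow_sq (n : ℕ) : ((-1 : ℝ) ^ n) ^ 2 = 1 := by
  rw [← pow_mul, mul_comm, pow_mul]; norm_num

theorem abs_neg_one_pow_mul (n : ℕ) (x : ℝ) : |(-1 : ℝ) ^ n * x| = |x| := by
  rw [abs_mul, abs_pow, abs_neg, abs_one, one_pow, one_mul]

/-- At this phase the cosine vanishes and the sine is (-1)^n, so the single-point part ±α₀ outweighs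
the multi-point terms. The bound is `DerivNonzeroCond` at λ = s². -/
theorem charFun_sign_neumann {Bm Bp : EndBC} (hBm : Bm.Admissible (-1)) {s : ℝ} {n : ℕ}
    (hs : 0 ≤ s) (hphase : phase Bm s = Real.pi / 2 + n * Real.pi)
    (h : Bp.sumα + s * Bp.sumβ < Bp.α₀) : 0 < (-1) ^ n * charFun Bm Bp s := by
  have hpos : 0 < phase Bm s := by rw [hphase]; positivity
  obtain ⟨r, hr, hr'⟩ := exists_charFun_eq hBm Bp hs hpos
  have h1 := abs_trigFun_sub_le Bm Bp hs
  rw [hphase, Real.sin_add_nat_mul_pi, Real.cos_add_nat_mul_pi, Real.sin_pi_div_two,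
    Real.cos_pi_div_two, ← abs_neg_one_pow_mul n] at h1
  have h2 := (abs_le.1 h1).2
  have h3 := neg_one_pow_sq n
  rw [show (-1 : ℝ) ^ n * (Bp.α₀ * ((-1) ^ n * 1) + Bp.β₀ * (s * ((-1) ^ n * 0)) -
    trigFun Bm Bp s) = Bp.α₀ - (-1) ^ n * trigFun Bm Bp s by linear_combination Bp.α₀ * h3] at h2
  have h4 : 0 < (-1) ^ n * trigFun Bm Bp s := by linarith
  rw [hr', mul_left_comm]
  exact mul_pos hr h4

/-- Here the sine vanishes and ±sβ₀ dominates. The bound is the inequality of `ValueNonzeroCond` at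
λ = s², multiplied by s. -/
theorem charFun_sign_dirichlet {Bm Bp : EndBC} (hBm : Bm.Admissible (-1)) {s : ℝ} {n : ℕ}
    (hs : 0 < s) (hphase : phase Bm s = n * Real.pi)
    (h : Bp.sumα + s * Bp.sumβ < s * Bp.β₀) : 0 < (-1) ^ n * charFun Bm Bp s := by
  obtain ⟨r, hr, hr'⟩ := exists_charFun_eq hBm Bp hs.le (phase_pos hBm hs)
  have h1 := abs_trigFun_sub_le Bm Bp hs.le
  rw [hphase, Real.sin_nat_mul_pi, Real.cos_nat_mul_pi, ← abs_neg_one_pow_mul n] at h1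
  have h2 := (abs_le.1 h1).2
  have h3 := neg_one_pow_sq n
  rw [show (-1 : ℝ) ^ n * (Bp.α₀ * 0 + Bp.β₀ * (s * (-1) ^ n) - trigFun Bm Bp s) =
    s * Bp.β₀ - (-1) ^ n * trigFun Bm Bp s by linear_combination s * Bp.β₀ * h3] at h2
  have h4 : 0 < (-1) ^ n * trigFun Bm Bp s := by linarith
  rw [hr', mul_left_comm]
  exact mul_pos hr h4

/-- There is no eigenvalue of small phase. -/
theorem charFun_ne_zero_of_phase_le {Bm Bp : EndBC} (hBm : Bm.Admissible (-1)) (hBp : Bp.Regular)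
    {s : ℝ} (hs : 0 ≤ s) (hphase : phase Bm s ≤ Real.pi / 2) (hα : 0 < Bp.α₀)
    (h : s * Bp.β₀ ≤ Bp.α₀) : charFun Bm Bp s ≠ 0 := by
  have hθ := angle_mem hBm hs
  rcases (show 0 ≤ phase Bm s by unfold phase; linarith [hθ.1]).eq_or_lt with h0 | h0
  · have hs0 : s = 0 := by
      have := hθ.1
      unfold phase at h0
      linarith
    rw [hs0]
    exact (charFun_zero_pos hBm hBp (by linarith [hBm.left_pos.1])).ne'
  obtain ⟨r, hr, hr'⟩ := exists_charFun_eq hBm Bp hs h0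
  rw [hr']
  refine (mul_pos hr ?_).ne'
  have hS : 0 < Real.sin (phase Bm s) := Real.sin_pos_of_pos_of_lt_pi h0 (by linarith)
  have hC : 0 ≤ Real.cos (phase Bm s) :=
    Real.cos_nonneg_of_neg_pi_div_two_le_of_le (by linarith) hphase
  have hSC := Real.sin_sq_add_cos_sq (phase Bm s)
  have hβ := hBp.β₀_nonneg
  refine EndBC.defect_pos hBp.η_mem (M := Real.sin (phase Bm s)) (M' := s) ?_ ?_ ?_
  · intro z hz
    have h1 : 0 ≤ s * z := mul_nonneg hs hz.1
    have h2 : s * z ≤ s * 2 := mul_le_mul_of_nonneg_left hz.2 hs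
    have h3 : s * z + angle Bm s ≤ phase Bm s := by unfold phase; linarith
    have h4 : 0 ≤ s * z + angle Bm s := by linarith [hθ.1]
    rw [abs_of_nonneg (Real.sin_nonneg_of_nonneg_of_le_pi h4 (by linarith))]
    exact Real.sin_le_sin_of_le_of_le_pi_div_two (by linarith) hphase h3
  · intro z _
    rw [abs_mul, abs_of_nonneg hs]
    exact mul_le_of_le_one_right hs (Real.abs_cos_le_one _)
  · change _ < Bp.α₀ * Real.sin (phase Bm s) + Bp.β₀ * (s * Real.cos (phase Bm s))
    have h1 := mul_pos hα hS
    have h2 := mul_nonneg hβ (mul_nonneg hs hC)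
    refine hBp.weighted_lt (by linarith) (by linarith) ?_
    -- Then α₀ sin φ ≥ sβ₀(1 - cos φ), so the end-point terms are at least sβ₀, the bound for the
    -- derivative part.
    have h3 : 1 ≤ Real.sin (phase Bm s) + Real.cos (phase Bm s) := by nlinarith
    have h4 := Real.cos_le_one (phase Bm s)
    nlinarith [mul_le_mul_of_nonneg_right h (sub_nonneg.2 h4)]

/-! ### Simplicity of the zeros of the characteristic function -/

theorem EndBC.hasDerivAt_defect (B : EndBC) {f f' : ℝ → ℝ → ℝ} {g g' : ℝ → ℝ} {s : ℝ}
    (hf : ∀ z, HasDerivAt (fun s => f s z) (g z) s)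
    (hf' : ∀ z, HasDerivAt (fun s => f' s z) (g' z) s) :
    HasDerivAt (fun s => B.defect (f s) (f' s)) (B.defect g g') s :=
  (((hf 2).const_mul B.α₀).add ((hf' 2).const_mul B.β₀)).sub
    ((HasDerivAt.fun_sum fun i _ => (hf (B.η i + 1)).const_mul (B.α i)).add
      (HasDerivAt.fun_sum fun i _ => (hf' (B.η i + 1)).const_mul (B.β i)))

/-- The derivative with respect to `s` of the phase at distance `z` from the left end point. -/
def phaseSpeed (B : EndBC) (s z : ℝ) : ℝ := z + Real.sin (angle B s) * Real.cos (angle B s) / s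

theorem hasDerivAt_phase_at (B : EndBC) {s : ℝ} (hs : 0 < s) (z : ℝ) :
    HasDerivAt (fun s => s * z + angle B s) (phaseSpeed B s z) s :=
  (hasDerivAt_mul_const z).add (hasDerivAt_angle hs)

theorem sin_mul_cos_angle_nonneg {B : EndBC} (hB : B.Admissible (-1)) {s : ℝ} (hs : 0 ≤ s) :
    0 ≤ Real.sin (angle B s) * Real.cos (angle B s) := by
  have hθ := angle_mem hB hs
  exact mul_nonneg (Real.sin_nonneg_of_nonneg_of_le_pi hθ.1 (by linarith [hθ.2, Real.pi_pos]))
    (Real.cos_nonneg_of_neg_pi_div_two_le_of_le (by linarith [hθ.1, Real.pi_pos]) hθ.2)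

theorem phase_sub_le_mul_phaseSpeed {B : EndBC} (hB : B.Admissible (-1)) {s : ℝ} (hs : 0 < s) :
    phase B s - Real.pi / 2 ≤ s * phaseSpeed B s 2 := by
  have h1 := sin_mul_cos_angle_nonneg hB hs.le
  have h2 := (angle_mem hB hs.le).2
  have h3 : s * phaseSpeed B s 2 = s * 2 + Real.sin (angle B s) * Real.cos (angle B s) := by
    unfold phaseSpeed
    field_simp
  rw [h3]
  unfold phase
  linarith

/-- The numerator of the quotient rule is again the defect of an explicit pair, because the defect
is linear; its sign can then be found by `EndBC.defect_pos`. -/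
theorem hasDerivAt_trigFun_div_cos {Bm Bp : EndBC} {s : ℝ} (hs : 0 < s)
    (hC : Real.cos (phase Bm s) ≠ 0) :
    HasDerivAt (fun s => trigFun Bm Bp s / Real.cos (phase Bm s))
      (Bp.defect
        (fun z => Real.cos (phase Bm s) * (Real.cos (s * z + angle Bm s) * phaseSpeed Bm s z) +
          Real.sin (phase Bm s) * phaseSpeed Bm s 2 * Real.sin (s * z + angle Bm s))
        (fun z => Real.cos (phase Bm s) * (Real.cos (s * z + angle Bm s) +
            s * (-Real.sin (s * z + angle Bm s) * phaseSpeed Bm s z)) +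
          Real.sin (phase Bm s) * phaseSpeed Bm s 2 * (s * Real.cos (s * z + angle Bm s))) /
        Real.cos (phase Bm s) ^ 2) s := by
  have h1 : HasDerivAt (trigFun Bm Bp)
      (Bp.defect (fun z => Real.cos (s * z + angle Bm s) * phaseSpeed Bm s z)
        (fun z => Real.cos (s * z + angle Bm s) +
          s * (-Real.sin (s * z + angle Bm s) * phaseSpeed Bm s z))) s :=
    Bp.hasDerivAt_defect (fun z => (hasDerivAt_phase_at Bm hs z).sin) fun z =>
      ((hasDerivAt_id' s).mul (hasDerivAt_phase_at Bm hs z).cos).congr_deriv (by ring)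
  refine (h1.div (hasDerivAt_phase_at Bm hs 2).cos hC).congr_deriv ?_
  congr 1
  rw [EndBC.defect_linear]
  change _ * Real.cos (phase Bm s) - trigFun Bm Bp s * (-Real.sin (phase Bm s) * _) = _
  unfold trigFun
  ring

/-- With p = -SC and C² = C⁴ + p², the difference of the two sides is (α² - x²)ρ² + 2αρxC² + x²p(2ρ
- p), each term of which is nonnegative. -/
theorem sq_bound_of_mul_nonpos {α x ρ S C : ℝ} (hx : 0 ≤ x) (hρ : 0 ≤ ρ) (hxα : x ≤ α)
    (hSC : S * C ≤ 0) (hSCρ : -(S * C) ≤ ρ) (hsq : S ^ 2 + C ^ 2 = 1) :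
    x ^ 2 * (ρ ^ 2 + 2 * ρ * (S * C) + C ^ 2) ≤ (α * ρ + x * C ^ 2) ^ 2 := by
  have h1 : 0 ≤ (α ^ 2 - x ^ 2) * ρ ^ 2 :=
    mul_nonneg (by nlinarith) (sq_nonneg ρ)
  have h2 : 0 ≤ 2 * (α * ρ) * (x * C ^ 2) := by
    have : 0 ≤ α := hx.trans hxα
    positivity
  have h3 : 0 ≤ x ^ 2 * (-(S * C) * (2 * ρ - -(S * C))) :=
    mul_nonneg (sq_nonneg x) (mul_nonneg (by linarith) (by linarith))
  have h4 : C ^ 2 = C ^ 4 + (S * C) ^ 2 := by linear_combination -C ^ 2 * hsq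
  nlinarith

/-- The difference of the two sides is (α² - x²)ρ² + 2ρx(αC² - xSC) - x²(SC)². The stronger bound on
x makes the middle term nonnegative and lets the first, at least α²S², absorb the last. -/
theorem sq_bound_of_mul_nonneg {α x ρ S C : ℝ} (hx : 0 ≤ x) (hα : 0 ≤ α) (hρ : 1 ≤ ρ)
    (hxα : x ≤ α * |C|) (hSC : 0 ≤ S * C) (hsq : S ^ 2 + C ^ 2 = 1) :
    x ^ 2 * (ρ ^ 2 + 2 * ρ * (S * C) + C ^ 2) ≤ (α * ρ + x * C ^ 2) ^ 2 := by
  have hS1 : |S| ≤ 1 := abs_le_one_iff_mul_self_le_one.2 (by nlinarith [sq_nonneg C])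
  have hC2 : |C| ^ 2 = C ^ 2 := sq_abs C
  have h1 : x * (S * C) ≤ α * C ^ 2 := by
    have e : S * C = |S| * |C| := by rw [← abs_mul, abs_of_nonneg hSC]
    calc x * (S * C) ≤ α * |C| * (S * C) := mul_le_mul_of_nonneg_right hxα hSC
      _ = α * C ^ 2 * |S| := by rw [e, ← hC2]; ring
      _ ≤ α * C ^ 2 * 1 := mul_le_mul_of_nonneg_left hS1 (by positivity)
      _ = α * C ^ 2 := mul_one _
  have h2 : 0 ≤ 2 * ρ * x * (α * C ^ 2 - x * (S * C)) :=
    mul_nonneg (by positivity) (by linarith)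
  have h3 : x ^ 2 ≤ α ^ 2 * C ^ 2 := by
    rw [← hC2, ← mul_pow]
    exact pow_le_pow_left₀ hx hxα 2
  have h4 : α ^ 2 * S ^ 2 ≤ (α ^ 2 - x ^ 2) * ρ ^ 2 := by
    have e1 : α ^ 2 * S ^ 2 ≤ α ^ 2 - x ^ 2 := by nlinarith
    have e2 : 0 ≤ α ^ 2 - x ^ 2 := le_trans (by positivity) e1
    nlinarith [mul_nonneg e2 (show 0 ≤ ρ ^ 2 - 1 by nlinarith)]
  have h5 : x ^ 2 * (S * C) ^ 2 ≤ α ^ 2 * S ^ 2 := by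
    have hC1 : C ^ 2 ≤ 1 := by nlinarith [sq_nonneg S]
    have e1 : x ^ 2 * C ^ 2 ≤ α ^ 2 := by nlinarith [sq_nonneg C, sq_nonneg α, sq_nonneg x]
    nlinarith [mul_le_mul_of_nonneg_right e1 (sq_nonneg S)]
  have h6 : C ^ 2 = C ^ 4 + (S * C) ^ 2 := by linear_combination -C ^ 2 * hsq
  nlinarith

/-- Positivity of the numerator of the derivative in `hasDerivAt_trigFun_div_cos`. -/
theorem deriv_numerator_pos {Bm Bp : EndBC} (hBm : Bm.Admissible (-1)) (hBp : Bp.Regular)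
    {s : ℝ} (hs : 0 < s) (hα : 0 < Bp.α₀)
    (h : (s * Bp.β₀) ^ 2 * ((s * phaseSpeed Bm s 2) ^ 2 + 2 * (s * phaseSpeed Bm s 2) *
        (Real.sin (phase Bm s) * Real.cos (phase Bm s)) + Real.cos (phase Bm s) ^ 2) ≤
      (Bp.α₀ * (s * phaseSpeed Bm s 2) + s * Bp.β₀ * Real.cos (phase Bm s) ^ 2) ^ 2) :
    0 < Bp.defect
        (fun z => Real.cos (phase Bm s) * (Real.cos (s * z + angle Bm s) * phaseSpeed Bm s z) +
          Real.sin (phase Bm s) * phaseSpeed Bm s 2 * Real.sin (s * z + angle Bm s))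
        (fun z => Real.cos (phase Bm s) * (Real.cos (s * z + angle Bm s) +
            s * (-Real.sin (s * z + angle Bm s) * phaseSpeed Bm s z)) +
          Real.sin (phase Bm s) * phaseSpeed Bm s 2 * (s * Real.cos (s * z + angle Bm s))) := by
  set T := phaseSpeed Bm s 2 with hT
  have hSC := Real.sin_sq_add_cos_sq (phase Bm s)
  set S := Real.sin (phase Bm s) with hS
  set C := Real.cos (phase Bm s) with hC
  have hsc : 0 ≤ Real.sin (angle Bm s) * Real.cos (angle Bm s) / s :=
    div_nonneg (sin_mul_cos_angle_nonneg hBm hs.le) hs.le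
  have hT2 : 2 ≤ T := by rw [hT]; unfold phaseSpeed; linarith
  have hβ := hBp.β₀_nonneg
  have hspeed : ∀ z ∈ Icc (0 : ℝ) 2, phaseSpeed Bm s z ^ 2 ≤ T ^ 2 := by
    intro z hz
    have h0 : 0 ≤ phaseSpeed Bm s z := by unfold phaseSpeed; linarith [hz.1]
    refine pow_le_pow_left₀ h0 ?_ 2
    rw [hT]; unfold phaseSpeed; linarith [hz.2]
  have hamp : ∀ A B x : ℝ, (A * Real.cos x + B * Real.sin x) ^ 2 ≤ A ^ 2 + B ^ 2 := by
    intro A B x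
    have := Real.sin_sq_add_cos_sq x
    nlinarith [sq_nonneg (A * Real.sin x - B * Real.cos x)]
  have hK0 : 0 ≤ (C + s * T * S) ^ 2 + (s * T * C) ^ 2 := by positivity
  -- Both functions have the form a cos + b sin, bounded by their amplitudes. At the right end they
  -- equal T and C², so only the comparison of the β-part remains, which is `h` divided by s².
  refine EndBC.defect_pos hBp.η_mem (M := T)
    (M' := √((C + s * T * S) ^ 2 + (s * T * C) ^ 2)) ?_ ?_ ?_
  · intro z hz
    refine abs_le_of_sq_le_sq ?_ (by linarith)
    have h1 := hamp (C * phaseSpeed Bm s z) (S * T) (s * z + angle Bm s)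
    have h2 := mul_le_mul_of_nonneg_left (hspeed z hz) (sq_nonneg C)
    nlinarith
  · intro z hz
    refine Real.abs_le_sqrt ?_
    have h1 := hamp (C + s * T * S) (-(s * phaseSpeed Bm s z * C)) (s * z + angle Bm s)
    have h2 := mul_le_mul_of_nonneg_left (hspeed z hz) (sq_nonneg (s * C))
    nlinarith
  · change _ < Bp.α₀ * (C * (C * T) + S * T * S) +
      Bp.β₀ * (C * (C + s * (-S * T)) + S * T * (s * C))
    have e1 : C * (C * T) + S * T * S = T := by linear_combination T * hSC
    have e2 : C * (C + s * (-S * T)) + S * T * (s * C) = C ^ 2 := by ring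
    rw [e1, e2]
    have h1 : 0 < Bp.α₀ * T := mul_pos hα (by linarith)
    have h2 : 0 ≤ Bp.β₀ * C ^ 2 := by positivity
    refine hBp.weighted_lt (by linarith) (by linarith) ?_
    refine (le_abs_self _).trans (abs_le_of_sq_le_sq ?_ (by linarith))
    rw [mul_pow, Real.sq_sqrt hK0]
    have hs2 : 0 < s ^ 2 := by positivity
    refine le_of_mul_le_mul_left ?_ hs2
    linear_combination h + s ^ 4 * Bp.β₀ ^ 2 * T ^ 2 * hSC

theorem charFun_zero_unique {Bm Bp : EndBC} (hBm : Bm.Admissible (-1)) (hBp : Bp.Regular)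
    {n : ℕ} {s₁ s₂ : ℝ} (h₁ : Real.pi / 2 + n * Real.pi < phase Bm s₁) (hlt : s₁ < s₂)
    (h₂ : phase Bm s₂ < Real.pi / 2 + (n + 1 : ℕ) * Real.pi) (hs₁ : 0 < s₁)
    (hα : Bp.sumα + s₂ * Bp.sumβ < Bp.α₀)
    (hβ : ∀ s, phase Bm s ≤ (n + 1 : ℕ) * Real.pi → s * Bp.β₀ ≤ Bp.α₀)
    (hz₁ : charFun Bm Bp s₁ = 0) (hz₂ : charFun Bm Bp s₂ = 0) : False := by
  have hcast : ((n + 1 : ℕ) : ℝ) * Real.pi = n * Real.pi + Real.pi := by push_cast; ring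
  have hmono := phase_strictMono hBm
  have htrig : ∀ s, 0 < s → charFun Bm Bp s = 0 → trigFun Bm Bp s = 0 := by
    intro s hs hz
    obtain ⟨r, hr, hr'⟩ := exists_charFun_eq hBm Bp hs.le (phase_pos hBm hs)
    rw [hr'] at hz
    exact (mul_eq_zero.1 hz).resolve_left hr.ne'
  have hs₂ : 0 < s₂ := hs₁.trans hlt
  have hα0 : 0 < Bp.α₀ := by
    have := Bp.sumα_nonneg
    have := mul_nonneg hs₂.le Bp.sumβ_nonneg
    linarith
  -- χ is the phase measured from the midpoint (n+1)π of the interval; the shift changes sine and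
  -- cosine by a common sign.
  have hshift : ∀ s, ∃ χ, phase Bm s = χ + (n + 1 : ℕ) * Real.pi ∧
      |Real.cos (phase Bm s)| = |Real.cos χ| ∧
      Real.sin (phase Bm s) * Real.cos (phase Bm s) = Real.sin χ * Real.cos χ := by
    intro s
    refine ⟨phase Bm s - (n + 1 : ℕ) * Real.pi, by ring, ?_, ?_⟩
    · rw [Real.cos_sub_nat_mul_pi, abs_neg_one_pow_mul]
    · rw [Real.cos_sub_nat_mul_pi, Real.sin_sub_nat_mul_pi]
      linear_combination -Real.sin (phase Bm s) * Real.cos (phase Bm s) * neg_one_pow_sq (n + 1)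
  have hcos : ∀ s ∈ Icc s₁ s₂, Real.cos (phase Bm s) ≠ 0 := by
    intro s hs
    obtain ⟨χ, hχ, hc, -⟩ := hshift s
    have h3 := hmono.monotone hs.1
    have h4 := hmono.monotone hs.2
    have : 0 < Real.cos χ := Real.cos_pos_of_mem_Ioo ⟨by linarith, by linarith⟩
    rw [← abs_pos, hc]
    exact abs_pos.2 this.ne'
  -- Rolle for the quotient by cos φ, which has no zero strictly between the two Neumann phases.
  obtain ⟨c, hc, hc'⟩ := exists_hasDerivAt_eq_zero hlt
    (fun s hs => (hasDerivAt_trigFun_div_cos (Bp := Bp) (hs₁.trans_le hs.1)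
      (hcos s hs)).continuousAt.continuousWithinAt)
    (by rw [htrig s₁ hs₁ hz₁, htrig s₂ hs₂ hz₂, zero_div, zero_div])
    (fun s hs => hasDerivAt_trigFun_div_cos (hs₁.trans hs.1) (hcos s (Ioo_subset_Icc_self hs)))
  have hc0 : 0 < c := hs₁.trans hc.1
  have hsq := Real.sin_sq_add_cos_sq (phase Bm c)
  have hρ := phase_sub_le_mul_phaseSpeed hBm hc0
  have hφ₁ := hmono hc.1
  have hφ₂ := hmono hc.2
  have hx : 0 ≤ c * Bp.β₀ := mul_nonneg hc0.le hBp.β₀_nonneg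
  have hn : 0 ≤ n * Real.pi := by positivity
  have hpi := Real.pi_gt_three
  refine (div_pos (deriv_numerator_pos hBm hBp hc0 hα0 ?_)
    (pow_pos (abs_pos.2 (hcos c (Ioo_subset_Icc_self hc))) 2)).ne' (by rwa [sq_abs])
  obtain ⟨χ, hχ, hcχ, hscχ⟩ := hshift c
  -- Up to the Dirichlet phase sin φ cos φ ≤ 0 and cβ₀ ≤ α₀ suffices. Beyond it, a sharper bound on
  -- cβ₀ comes from the supposed zero at s₂.
  rcases le_or_gt (phase Bm c) ((n + 1 : ℕ) * Real.pi) with hle | hgt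
  · refine sq_bound_of_mul_nonpos hx (by linarith) (hβ c hle) ?_ ?_ hsq
    · rw [hscχ]
      exact mul_nonpos_of_nonpos_of_nonneg
        (Real.sin_nonpos_of_nonpos_of_neg_pi_le (by linarith) (by linarith))
        (Real.cos_nonneg_of_neg_pi_div_two_le_of_le (by linarith) (by linarith))
    · refine le_trans ?_ hρ
      have e1 : Real.cos (phase Bm c) = -Real.sin (phase Bm c - Real.pi / 2) := by
        rw [Real.sin_sub_pi_div_two, neg_neg]
      have h5 : |Real.cos (phase Bm c)| ≤ phase Bm c - Real.pi / 2 := by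
        rw [e1, abs_neg]
        have := Real.abs_sin_le_abs (x := phase Bm c - Real.pi / 2)
        rwa [abs_of_nonneg (show 0 ≤ phase Bm c - Real.pi / 2 by linarith)] at this
      refine (neg_le_abs _).trans ?_
      rw [abs_mul]
      exact (mul_le_of_le_one_left (abs_nonneg _) (Real.abs_sin_le_one _)).trans h5
  · obtain ⟨ξ, hξ, -, -⟩ := hshift s₂
    have hχξ : χ < ξ := by linarith
    have hχ0 : 0 < χ := by linarith
    have hξ2 : ξ < Real.pi / 2 := by linarith
    have hcosξ : 0 < Real.cos ξ := Real.cos_pos_of_mem_Ioo ⟨by linarith, hξ2⟩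
    have hcosχ : 0 < Real.cos χ := Real.cos_pos_of_mem_Ioo ⟨by linarith, by linarith⟩
    have hsinξ : 0 < Real.sin ξ := Real.sin_pos_of_pos_of_lt_pi (by linarith) (by linarith)
    have hsinχ : 0 < Real.sin χ := Real.sin_pos_of_pos_of_lt_pi (by linarith) (by linarith)
    refine sq_bound_of_mul_nonneg hx hα0.le ?_ ?_ ?_ hsq
    · linarith
    · have h5 := abs_trigFun_sub_le Bm Bp hs₂.le
      rw [htrig s₂ hs₂ hz₂, sub_zero, hξ, Real.sin_add_nat_mul_pi, Real.cos_add_nat_mul_pi,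
        show Bp.α₀ * ((-1) ^ (n + 1) * Real.sin ξ) + Bp.β₀ * (s₂ * ((-1) ^ (n + 1) * Real.cos ξ)) =
          (-1) ^ (n + 1) * (Bp.α₀ * Real.sin ξ + Bp.β₀ * (s₂ * Real.cos ξ)) by ring,
        abs_neg_one_pow_mul] at h5
      have h6 := (le_abs_self _).trans h5
      have h7 : Real.cos ξ < Real.cos χ :=
        Real.cos_lt_cos_of_nonneg_of_le_pi_div_two hχ0.le hξ2.le hχξ
      have h8 : s₂ * Bp.β₀ ≤ Bp.α₀ * Real.cos ξ := by
        -- Since s₂ is a zero, α₀ sin ξ + s₂β₀ cos ξ ≤ A + s₂B < α₀, so s₂β₀ cos ξ is below α₀(1 -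
        -- sin ξ) ≤ α₀ cos²ξ. As c < s₂ and cos ξ < cos χ, the bound passes to c.
        refine le_of_mul_le_mul_right ?_ hcosξ
        have h9 : 1 - Real.sin ξ ≤ Real.cos ξ ^ 2 := by
          nlinarith [Real.sin_sq_add_cos_sq ξ, Real.sin_le_one ξ]
        have h10 := mul_le_mul_of_nonneg_left h9 hα0.le
        linarith only [h6, hα, h10]
      rw [hcχ, abs_of_pos hcosχ]
      exact (mul_le_mul_of_nonneg_right hc.2.le hBp.β₀_nonneg).trans
        (h8.trans (mul_le_mul_of_nonneg_left h7.le hα0.le))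
    · rw [hscχ]; positivity

/-! ### Enumeration of the eigenvalues -/

theorem exists_least_zero {f : ℝ → ℝ} (hf : Continuous f) {a b : ℝ} (hab : a < b)
    (h : f a * f b < 0) : ∃ z ∈ Ioo a b, f z = 0 ∧ ∀ t ∈ Ico a z, f t ≠ 0 := by
  have ha : f a ≠ 0 := fun h0 => by simp [h0] at h
  have hb : f b ≠ 0 := fun h0 => by simp [h0] at h
  have hne : (Icc a b ∩ f ⁻¹' {0}).Nonempty := by
    have h0 : (0 : ℝ) ∈ uIcc (f a) (f b) := by
      rw [mem_uIcc]
      rcases mul_neg_iff.1 h with h' | h'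
      · exact Or.inr ⟨h'.2.le, h'.1.le⟩
      · exact Or.inl ⟨h'.1.le, h'.2.le⟩
    obtain ⟨z, hz, hz'⟩ := intermediate_value_uIcc hf.continuousOn h0
    rw [uIcc_of_le hab.le] at hz
    exact ⟨z, hz, hz'⟩
  obtain ⟨z, ⟨hz, hz0⟩, hmin⟩ :=
    (isCompact_Icc.inter_right (isClosed_singleton.preimage hf)).exists_isLeast hne
  refine ⟨z, ⟨lt_of_le_of_ne hz.1 ?_, lt_of_le_of_ne hz.2 ?_⟩, hz0, fun t ht h0 => ?_⟩
  · rintro rfl; exact ha hz0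
  · rintro rfl; exact hb hz0
  · exact not_lt.2 (hmin ⟨⟨ht.1, ht.2.le.trans hz.2⟩, h0⟩) ht.2

section Count

variable {Bm Bp : EndBC} (hBm : Bm.Admissible (-1)) (hα : Bm.α = 0) (hβ : Bm.β = 0)
  (hBp : Bp.Regular)

include hBm hα hβ hBp

theorem isKthEigenvalue_zero_of_least {z : ℝ} (hz : 0 ≤ z) (h0 : charFun Bm Bp z = 0)
    (hlt : ∀ t, 0 ≤ t → t < z → charFun Bm Bp t ≠ 0) : IsKthEigenvalue Bm Bp 0 (z ^ 2) := by
  refine isKthEigenvalue_zero ((sq_mem_eigenvalues_iff hBm hα hβ hBp z).2 h0) fun mu hmu => ?_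
  obtain ⟨t, ht, rfl, ht0⟩ := exists_sq_of_mem_eigenvalues hBm hα hβ hBp hmu
  exact pow_le_pow_left₀ hz (not_lt.1 fun h => hlt t ht h ht0) 2

theorem isKthEigenvalue_succ_of_least {k : ℕ} {y z : ℝ} (h : IsKthEigenvalue Bm Bp k (y ^ 2))
    (hy : 0 ≤ y) (hyz : y < z) (h0 : charFun Bm Bp z = 0)
    (hlt : ∀ t, y < t → t < z → charFun Bm Bp t ≠ 0) :
    IsKthEigenvalue Bm Bp (k + 1) (z ^ 2) := by
  refine h.succ ((sq_mem_eigenvalues_iff hBm hα hβ hBp z).2 h0)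
    (pow_lt_pow_left₀ hyz hy two_ne_zero) fun mu hmu hlt' => ?_
  obtain ⟨t, ht, rfl, ht0⟩ := exists_sq_of_mem_eigenvalues hBm hα hβ hBp hmu
  exact pow_le_pow_left₀ (hy.trans hyz.le)
    (not_lt.1 fun h' => hlt t (lt_of_pow_lt_pow_left₀ 2 ht hlt') h' ht0) 2

/-- The eigenvalues of a problem whose characteristic equation prescribes the phase. -/
theorem isKthEigenvalue_of_phase {y : ℝ} (hy : angle Bm 0 ≤ y)
    (h : ∀ s, 0 ≤ s → (charFun Bm Bp s = 0 ↔ ∃ n : ℕ, phase Bm s = y + n * Real.pi)) (n : ℕ) :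
    ∀ s, 0 ≤ s → phase Bm s = y + n * Real.pi → IsKthEigenvalue Bm Bp n (s ^ 2) := by
  have hmono := phase_strictMono hBm
  induction n with
  | zero =>
    intro s hs hphase
    refine isKthEigenvalue_zero_of_least hBm hα hβ hBp hs ((h s hs).2 ⟨0, hphase⟩)
      fun t ht hts h0 => ?_
    obtain ⟨m, hm⟩ := (h t ht).1 h0
    have h1 := hmono hts
    rw [hm, hphase] at h1
    have h2 : 0 ≤ m * Real.pi := by positivity
    norm_num at h1
    linarith
  | succ n ih =>
    intro s hs hphase
    obtain ⟨r, hr, hr'⟩ := exists_phase_eq hBm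
      (le_trans hy (le_add_of_nonneg_right (show 0 ≤ n * Real.pi by positivity)))
    have hrs : r < s := by
      rw [← hmono.lt_iff_lt, hr', hphase]
      push_cast
      linarith [Real.pi_pos]
    refine isKthEigenvalue_succ_of_least hBm hα hβ hBp (ih r hr hr') hr hrs
      ((h s hs).2 ⟨n + 1, hphase⟩) fun t hrt hts h0 => ?_
    obtain ⟨m, hm⟩ := (h t (hr.trans hrt.le)).1 h0
    have h1 := hmono hrt
    have h2 := hmono hts
    rw [hr', hm] at h1
    rw [hm, hphase] at h2
    have h3 : n < m := by
      have := lt_of_mul_lt_mul_right (lt_of_add_lt_add_left h1) Real.pi_pos.le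
      exact_mod_cast this
    have h4 : m < n + 1 := by
      have := lt_of_mul_lt_mul_right (lt_of_add_lt_add_left h2) Real.pi_pos.le
      exact_mod_cast this
    omega

end Count

/-- Phase 0 is not in the list: it occurs only at s = 0, where the solution is not a sine and its
end value is positive. -/
theorem charFun_dirichlet_eq_zero_iff {Bm : EndBC} (hBm : Bm.Admissible (-1)) {s : ℝ}
    (hs : 0 ≤ s) : charFun Bm EndBC.dirichlet s = 0 ↔
      ∃ n : ℕ, phase Bm s = Real.pi + n * Real.pi := by
  have hθ := angle_mem hBm hs
  rcases (show 0 ≤ phase Bm s by unfold phase; linarith [hθ.1]).eq_or_lt with h0 | h0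
  · have hs0 : s = 0 := by
      have := hθ.1
      unfold phase at h0
      linarith
    rw [← h0, hs0]
    refine iff_of_false (charFun_zero_pos hBm EndBC.dirichlet_regular ?_).ne' ?_
    · have : EndBC.dirichlet.α₀ = 1 := rfl
      linarith [hBm.left_pos.1]
    · rintro ⟨n, hn⟩
      have : 0 ≤ n * Real.pi := by positivity
      linarith [Real.pi_pos]
  · obtain ⟨r, hr, hr'⟩ := exists_charFun_eq hBm EndBC.dirichlet hs h0
    rw [hr', mul_eq_zero, or_iff_right hr.ne', trigFun, EndBC.dirichlet_defect]
    change Real.sin (phase Bm s) = 0 ↔ _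
    rw [Real.sin_eq_zero_iff]
    constructor
    · rintro ⟨m, hm⟩
      have hm0 : 0 < m := by
        by_contra hn
        have : (m : ℝ) ≤ 0 := by exact_mod_cast not_lt.1 hn
        nlinarith [Real.pi_pos]
      obtain ⟨n, rfl⟩ : ∃ n : ℕ, m = n + 1 := ⟨(m - 1).toNat, by omega⟩
      refine ⟨n, ?_⟩
      rw [← hm]
      push_cast
      ring
    · rintro ⟨n, hn⟩
      exact ⟨n + 1, by rw [hn]; push_cast; ring⟩

theorem charFun_neumann_eq_zero_iff {Bm : EndBC} (hBm : Bm.Admissible (-1)) {s : ℝ}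
    (hs : 0 ≤ s) : charFun Bm EndBC.neumann s = 0 ↔
      ∃ n : ℕ, phase Bm s = Real.pi / 2 + n * Real.pi := by
  have hθ := angle_mem hBm hs
  have hpi := Real.pi_pos
  rcases (show 0 ≤ phase Bm s by unfold phase; linarith [hθ.1]).eq_or_lt with h0 | h0
  · have hs0 : s = 0 := by
      have := hθ.1
      unfold phase at h0
      linarith
    have ha : 0 < Bm.α₀ := by
      refine lt_of_le_of_ne hBm.left_pos.1 fun ha => ?_
      simp [phase, angle, hs0, ← ha] at h0
      linarith
    rw [← h0, hs0]
    refine iff_of_false (charFun_zero_pos hBm EndBC.neumann_regular ?_).ne' ?_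
    · linarith [EndBC.neumann_regular.α₀_nonneg]
    · rintro ⟨n, hn⟩
      have : 0 ≤ n * Real.pi := by positivity
      linarith
  · obtain ⟨r, hr, hr'⟩ := exists_charFun_eq hBm EndBC.neumann hs h0
    rw [hr', mul_eq_zero, or_iff_right hr.ne', trigFun, EndBC.neumann_defect, mul_eq_zero]
    change s = 0 ∨ Real.cos (phase Bm s) = 0 ↔ _
    -- The factor s contributes no extra zero: s = 0 with positive phase means a left Neumann
    -- condition, whose phase is π/2.
    have hs0 : s = 0 → Real.cos (phase Bm s) = 0 := fun hs0 => by
      rcases pos_or_of_phase_pos hs h0 with h' | ⟨-, h'⟩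
      · exact absurd hs0 h'.ne'
      · simp [phase, angle, hs0, h']
    rw [or_iff_right_of_imp hs0, Real.cos_eq_zero_iff]
    constructor
    · rintro ⟨m, hm⟩
      have hm0 : 0 ≤ m := by
        by_contra hn
        have : (m : ℝ) ≤ -1 := by exact_mod_cast (show m ≤ -1 by omega)
        nlinarith
      lift m to ℕ using hm0
      refine ⟨m, ?_⟩
      rw [hm]
      push_cast
      ring
    · rintro ⟨n, hn⟩
      exact ⟨n, by rw [hn]; push_cast; ring⟩

theorem angle_zero_le {B : EndBC} (hB : B.Admissible (-1)) : angle B 0 ≤ Real.pi / 2 :=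
  (angle_mem hB le_rfl).2

theorem eigRD_eq {Bm : EndBC} (hBm : Bm.Admissible (-1)) (hα : Bm.α = 0) (hβ : Bm.β = 0)
    {s : ℝ} (hs : 0 ≤ s) {n : ℕ} (h : phase Bm s = (n + 1 : ℕ) * Real.pi) :
    eigRD Bm n = s ^ 2 := by
  rw [eigRD, EndBC.singlePoint_eq hα hβ]
  refine (isKthEigenvalue_of_phase hBm hα hβ EndBC.dirichlet_regular (y := Real.pi) ?_
    (fun s hs => charFun_dirichlet_eq_zero_iff hBm hs) n s hs ?_).eigenvalue_eq
  · linarith [angle_zero_le hBm, Real.pi_pos]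
  · rw [h]; push_cast; ring

theorem eigRN_eq {Bm : EndBC} (hBm : Bm.Admissible (-1)) (hα : Bm.α = 0) (hβ : Bm.β = 0)
    {s : ℝ} (hs : 0 ≤ s) {n : ℕ} (h : phase Bm s = Real.pi / 2 + n * Real.pi) :
    eigRN Bm n = s ^ 2 := by
  rw [eigRN, EndBC.singlePoint_eq hα hβ]
  exact (isKthEigenvalue_of_phase hBm hα hβ EndBC.neumann_regular (angle_zero_le hBm)
    (fun s hs => charFun_neumann_eq_zero_iff hBm hs) n s hs h).eigenvalue_eq

theorem eigRD_neg (Bm : EndBC) {k : ℤ} (hk : k < 0) : eigRD Bm k = 0 := by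
  simp [eigRD, eigenvalue, hk]

/-! ### Nodal properties -/

/-- On `[-1, 1]`, `u` is the solution with phase function `s (x + 1) + angle B s` and
amplitude `c`. -/
structure IsSine (B : EndBC) (s c : ℝ) (u : ℝ → ℝ) : Prop where
  c2 : IsC2 u
  eq : ∀ x ∈ I, u x = c * Real.sin (s * (x + 1) + angle B s)
  d1_eq : ∀ x ∈ I, d1 u x = c * (s * Real.cos (s * (x + 1) + angle B s))

theorem IsSine.neg {B : EndBC} {s c : ℝ} {u : ℝ → ℝ} (h : IsSine B s c u) :
    IsSine B s (-c) (-u) := by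
  refine ⟨h.c2.neg, fun x hx => ?_, fun x hx => ?_⟩
  · rw [Pi.neg_apply, h.eq x hx, neg_mul]
  · rw [d1, derivWithin.neg, neg_mul, ← h.d1_eq x hx, d1]

theorem IsSine.mem_symmetrize {B : EndBC} {s c : ℝ} {u : ℝ → ℝ} {A : Set (ℝ → ℝ)}
    (h : IsSine B s c u) (hc : c ≠ 0) (hA : ∀ c' v, 0 < c' → IsSine B s c' v → v ∈ A) :
    u ∈ symmetrize A := by
  rcases hc.lt_or_gt with hc | hc
  · exact Or.inr (hA _ _ (neg_pos.2 hc) h.neg)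
  · exact Or.inl (hA _ _ hc h)

theorem IsSine.d1_d1_eq {B : EndBC} {s c : ℝ} {u : ℝ → ℝ} (h : IsSine B s c u) :
    ∀ x ∈ I, d1 (d1 u) x = -(c * (s * (s * Real.sin (s * (x + 1) + angle B s)))) := by
  intro x hx
  rw [d1_congr (v := fun x => c * (s * Real.cos (s * (x + 1) + angle B s))) h.d1_eq hx]
  refine d1_eq_of_hasDerivAt hx ?_
  have h1 : HasDerivAt (fun x => s * (x + 1) + angle B s) s x := by
    simpa using (((hasDerivAt_id' x).add_const 1).const_mul s).add_const (angle B s)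
  exact ((h1.cos.const_mul s).const_mul c).congr_deriv (by ring)

theorem IsEigenfunction.exists_isSine {Bm Bp : EndBC} {u : ℝ → ℝ} {s : ℝ}
    (hBm : Bm.Admissible (-1)) (hα : Bm.α = 0) (hβ : Bm.β = 0) (hs : 0 < s ∨ s = 0 ∧ Bm.α₀ = 0)
    (hu : IsEigenfunction Bm Bp (s ^ 2) u) : ∃ c ≠ 0, IsSine Bm s c u := by
  obtain ⟨c, hc, h⟩ := hu.eq_wave hBm hα hβ
  obtain ⟨r, hr, hw⟩ := exists_wave_eq hBm hs
  refine ⟨c * r, mul_ne_zero hc hr.ne', hu.c2, fun x hx => ?_, fun x hx => ?_⟩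
  · rw [(h x hx).1, (hw _).1, mul_assoc]
  · rw [(h x hx).2, (hw _).2, mul_assoc]

/-- The phase is affine and injective in x, so counting zeros is counting the indices of the phase
values they take. -/
theorem encard_phase_grid {s θ y : ℝ} (hs : 0 < s) {J : Set ℝ} {P : ℝ → Prop} {k : ℕ}
    (hJ : ∀ x, ∀ i < k, s * (x + 1) + θ = y + i * Real.pi → x ∈ J)
    (hP : ∀ x ∈ J, P x ↔ ∃ i < k, s * (x + 1) + θ = y + i * Real.pi) :
    {x ∈ J | P x}.encard = k := by
  have hx : ∀ (x : ℝ) (i : ℕ), (y + i * Real.pi - θ) / s - 1 = x ↔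
      s * (x + 1) + θ = y + i * Real.pi := by
    intro x i
    rw [sub_eq_iff_eq_add, div_eq_iff hs.ne', sub_eq_iff_eq_add, mul_comm (x + 1) s, eq_comm]
  have hset : {x ∈ J | P x} = (fun i : ℕ => (y + i * Real.pi - θ) / s - 1) '' Iio k := by
    ext x
    simp only [mem_ofPred_eq, mem_image, mem_Iio, hx]
    constructor
    · rintro ⟨h1, h2⟩
      exact (hP x h1).1 h2
    · rintro ⟨i, hi, h⟩
      have h1 := hJ x i hi h
      exact ⟨h1, (hP x h1).2 ⟨i, hi, h⟩⟩
  have hinj : Function.Injective (fun i : ℕ => (y + i * Real.pi - θ) / s - 1) := by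
    intro i j hij
    have h1 := (hx _ i).1 rfl
    have h2 := (hx _ j).1 hij.symm
    rw [h1] at h2
    exact_mod_cast mul_right_cancel₀ Real.pi_ne_zero (add_left_cancel h2)
  rw [hset, hinj.encard_image, ← Finset.coe_Iio, encard_coe_eq_coe_finsetCard, Nat.card_Iio]

theorem phase_at_mem {B : EndBC} {s : ℝ} (hs : 0 < s) {x : ℝ} :
    (-1 < x ↔ angle B s < s * (x + 1) + angle B s) ∧
      (x < 1 ↔ s * (x + 1) + angle B s < phase B s) := by
  unfold phase
  constructor
  · constructor
    · intro h
      nlinarith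
    · intro h
      have : 0 < s * (x + 1) := by linarith
      linarith [pos_of_mul_pos_right this hs.le]
  · rw [add_lt_add_iff_right, mul_lt_mul_iff_right₀ hs]
    constructor <;> intro h <;> linarith

theorem angle_lt {B : EndBC} (h : B.α₀ ≠ 0) (s : ℝ) : angle B s < Real.pi / 2 := by
  simp only [angle, h, if_false]
  exact Real.arctan_lt_pi_div_two _

theorem angle_of_neumann {B : EndBC} (h : B.α₀ = 0) (s : ℝ) : angle B s = Real.pi / 2 := by
  simp [angle, h]

/-- The phase runs from θ in [0, π/2] to a value between kπ and (k+1)π, so the interior zeros are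
those of phase π, ..., kπ. -/
theorem IsSine.mem_nodalS {B : EndBC} (hB : B.Admissible (-1)) {s c : ℝ} {u : ℝ → ℝ}
    (h : IsSine B s c u) (hc : c ≠ 0) (hs : 0 < s) {k : ℕ} (h₁ : k * Real.pi < phase B s)
    (h₂ : phase B s < (k + 1 : ℕ) * Real.pi) : u ∈ nodalS B k := by
  have hθ := angle_mem hB hs.le
  have hpi := Real.pi_pos
  refine h.mem_symmetrize hc fun c u hc h => ?_
  have hleft := h.eq (-1) (by norm_num)
  have hleft' := h.d1_eq (-1) (by norm_num)
  have hright := h.eq 1 (by norm_num)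
  rw [neg_add_cancel, mul_zero, zero_add] at hleft hleft'
  have hright0 : u 1 ≠ 0 := by
    rw [hright, show s * (1 + 1) + angle B s = phase B s by unfold phase; ring]
    refine mul_ne_zero hc.ne' fun h0 => ?_
    obtain ⟨m, hm⟩ := Real.sin_eq_zero_iff.1 h0
    rw [← hm] at h₁ h₂
    have e1 := lt_of_mul_lt_mul_right h₁ hpi.le
    have e2 := lt_of_mul_lt_mul_right h₂ hpi.le
    have e1' : (k : ℤ) < m := by exact_mod_cast e1
    have e2' : m < (k : ℤ) + 1 := by exact_mod_cast e2
    omega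
  have hzeros : HasSimpleZeros u (Ioo (-1) 1) k := by
    constructor
    · intro x hx h0
      have hx' := Ioo_subset_Icc_self hx
      rw [h.eq x hx', mul_eq_zero, or_iff_right hc.ne'] at h0
      rw [h.d1_eq x hx']
      refine mul_ne_zero hc.ne' (mul_ne_zero hs.ne' fun h1 => ?_)
      have := Real.sin_sq_add_cos_sq (s * (x + 1) + angle B s)
      rw [h0, h1] at this
      norm_num at this
    · refine encard_phase_grid (θ := angle B s) (y := Real.pi) hs ?_ ?_
      · intro x i hi hx
        refine ⟨(phase_at_mem (B := B) hs).1.2 ?_, (phase_at_mem hs).2.2 (lt_of_le_of_lt ?_ h₁)⟩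
        · have : 0 ≤ i * Real.pi := by positivity
          rw [hx]; linarith [hθ.2]
        · rw [hx]
          have : ((i : ℝ) + 1) ≤ k := by exact_mod_cast hi
          nlinarith
      · intro x hx
        have e1 := (phase_at_mem (B := B) hs).1.1 hx.1
        have e2 := (phase_at_mem (B := B) hs).2.1 hx.2
        rw [h.eq x (Ioo_subset_Icc_self hx), mul_eq_zero, or_iff_right hc.ne',
          Real.sin_eq_zero_iff]
        constructor
        · rintro ⟨m, hm⟩
          rw [← hm] at e1 e2 ⊢
          have e3 : (0 : ℝ) < m := pos_of_mul_pos_left (hθ.1.trans_lt e1) hpi.le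
          have e3' : 0 < m := by exact_mod_cast e3
          have e4 := lt_of_mul_lt_mul_right (e2.trans h₂) hpi.le
          have e4' : m < (k : ℤ) + 1 := by exact_mod_cast e4
          obtain ⟨i, rfl⟩ : ∃ i : ℕ, m = i + 1 := ⟨(m - 1).toNat, by omega⟩
          exact ⟨i, by omega, by push_cast; ring⟩
        · rintro ⟨i, -, hi⟩
          exact ⟨i + 1, by rw [hi]; push_cast; ring⟩
  split_ifs with hβ
  · have ha : B.α₀ ≠ 0 := fun ha => by
      have := hB.left_pos.2.2
      simp [ha, hβ] at this
    have h0 : angle B s = 0 := by simp [angle, ha, hβ]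
    refine ⟨h.c2, ?_, ?_, hright0, hzeros⟩
    · rw [hleft, h0, Real.sin_zero, mul_zero]
    · rw [hleft', h0, Real.cos_zero]; positivity
  · refine ⟨h.c2, ?_, hright0, hzeros⟩
    have h0 : 0 < angle B s := by
      by_cases ha : B.α₀ = 0
      · rw [angle_of_neumann ha]; positivity
      · have h1 : 0 < B.α₀ := lt_of_le_of_ne hB.left_pos.1 (Ne.symm ha)
        have h2 : 0 < -B.β₀ := lt_of_le_of_ne hB.left_pos.2.1 fun h0 => hβ (by linarith)
        simp only [angle, ha, if_false]
        exact Real.arctan_pos.2 (by positivity)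
    rw [hleft]
    exact mul_pos hc (Real.sin_pos_of_pos_of_lt_pi h0 (by linarith [hθ.2]))

theorem IsSine.mem_nodalS_zero_of_const {B : EndBC} (hB : B.Admissible (-1)) (ha : B.α₀ = 0)
    {c : ℝ} {u : ℝ → ℝ} (h : IsSine B 0 c u) (hc : c ≠ 0) : u ∈ nodalS B 0 := by
  refine h.mem_symmetrize hc fun c u hc h => ?_
  have hu : ∀ x ∈ I, u x = c := fun x hx => by
    rw [h.eq x hx, angle_of_neumann ha, zero_mul, zero_add, Real.sin_pi_div_two, mul_one]
  have hβ : B.β₀ ≠ 0 := fun hβ => by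
    have := hB.left_pos.2.2
    simp [ha, hβ] at this
  rw [if_neg hβ]
  have hne : ∀ x ∈ Ioo (-1 : ℝ) 1, u x ≠ 0 := fun x hx => by
    rw [hu x (Ioo_subset_Icc_self hx)]; exact hc.ne'
  refine ⟨h.c2, ?_, ?_, fun x hx h0 => absurd h0 (hne x hx), ?_⟩
  · rwa [hu (-1) (by norm_num)]
  · rw [hu 1 (by norm_num)]; exact hc.ne'
  · rw [Nat.cast_zero, encard_eq_zero]
    exact eq_empty_of_forall_notMem fun x hx => hne x hx.1 hx.2

/-- The zeros of u' have phase π/2 + iπ with 0 ≤ i ≤ k, hence k + 1 of them. For the left Neumann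
condition θ = π/2 and the zero with i = 0 sits at -1. -/
theorem IsSine.mem_nodalT {B : EndBC} (hB : B.Admissible (-1)) {s c : ℝ} {u : ℝ → ℝ}
    (h : IsSine B s c u) (hc : c ≠ 0) (hs : 0 < s) {k : ℕ}
    (h₁ : Real.pi / 2 + k * Real.pi < phase B s)
    (h₂ : phase B s < Real.pi / 2 + (k + 1 : ℕ) * Real.pi) : u ∈ nodalT B (k + 1) := by
  have hθ := angle_mem hB hs.le
  have hpi := Real.pi_pos
  refine h.mem_symmetrize hc fun c u hc h => ?_
  have hleft := h.eq (-1) (by norm_num)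
  have hleft' := h.d1_eq (-1) (by norm_num)
  have hright := h.d1_eq 1 (by norm_num)
  rw [neg_add_cancel, mul_zero, zero_add] at hleft hleft'
  have hcos : ∀ x ∈ I, d1 u x = 0 ↔
      ∃ m : ℤ, s * (x + 1) + angle B s = Real.pi / 2 + m * Real.pi := by
    intro x hx
    rw [h.d1_eq x hx, mul_eq_zero, or_iff_right hc.ne', mul_eq_zero, or_iff_right hs.ne',
      Real.cos_eq_zero_iff]
    refine exists_congr fun m => ?_
    rw [show (2 * (m : ℝ) + 1) * Real.pi / 2 = Real.pi / 2 + m * Real.pi by ring]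
  have hright0 : d1 u 1 ≠ 0 := by
    intro h0
    obtain ⟨m, hm⟩ := (hcos 1 (by norm_num)).1 h0
    rw [show s * (1 + 1) + angle B s = phase B s by unfold phase; ring] at hm
    rw [hm] at h₁ h₂
    have e1 := lt_of_mul_lt_mul_right (lt_of_add_lt_add_left h₁) hpi.le
    have e2 := lt_of_mul_lt_mul_right (lt_of_add_lt_add_left h₂) hpi.le
    have e1' : (k : ℤ) < m := by exact_mod_cast e1
    have e2' : m < (k : ℤ) + 1 := by exact_mod_cast e2
    omega
  have hsimple : ∀ x ∈ I, d1 u x = 0 → d1 (d1 u) x ≠ 0 := by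
    intro x hx h0
    rw [h.d1_eq x hx, mul_eq_zero, or_iff_right hc.ne', mul_eq_zero, or_iff_right hs.ne'] at h0
    rw [h.d1_d1_eq x hx, neg_ne_zero]
    refine mul_ne_zero hc.ne' (mul_ne_zero hs.ne' (mul_ne_zero hs.ne' fun h1 => ?_))
    have := Real.sin_sq_add_cos_sq (s * (x + 1) + angle B s)
    rw [h0, h1] at this
    norm_num at this
  have hcount : ∀ J : Set ℝ, J ⊆ Ico (-1) 1 →
      (∀ x, ∀ i < k + 1, s * (x + 1) + angle B s = Real.pi / 2 + i * Real.pi → x ∈ J) →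
      HasSimpleZeros (d1 u) J (k + 1) := by
    intro J hJ hgrid
    refine ⟨fun x hx => hsimple x (Ico_subset_Icc_self (hJ hx)),
      encard_phase_grid (θ := angle B s) (y := Real.pi / 2) hs hgrid fun x hx => ?_⟩
    rw [hcos x (Ico_subset_Icc_self (hJ hx))]
    have e1 : 0 ≤ s * (x + 1) := mul_nonneg hs.le (by linarith [(hJ hx).1])
    have e2 := (phase_at_mem (B := B) hs).2.1 (hJ hx).2
    constructor
    · rintro ⟨m, hm⟩
      rw [hm] at e2
      have e3 : (-1 : ℝ) < m := by
        by_contra hn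
        nlinarith [hθ.1]
      have e3' : -1 < m := by exact_mod_cast e3
      have e4 := lt_of_mul_lt_mul_right (lt_of_add_lt_add_left (e2.trans h₂)) hpi.le
      have e4' : m < (k : ℤ) + 1 := by exact_mod_cast e4
      lift m to ℕ using by omega
      exact ⟨m, by omega, by simpa using hm⟩
    · rintro ⟨i, -, hi⟩
      exact ⟨i, by simpa using hi⟩
  have hgridlt : ∀ x, ∀ i < k + 1, s * (x + 1) + angle B s = Real.pi / 2 + i * Real.pi →
      x < 1 := by
    intro x i hi hx
    refine (phase_at_mem hs).2.2 (lt_of_le_of_lt ?_ h₁)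
    rw [hx]
    have : (i : ℝ) ≤ k := by exact_mod_cast Nat.lt_succ_iff.1 hi
    nlinarith
  have hbetween : ∀ J : Set ℝ, J ⊆ Ico (-1) 1 → ZeroBetween u J := by
    intro J hJ x hx y hy hxy hx0 hy0 _
    obtain ⟨m, hm⟩ := (hcos x (Ico_subset_Icc_self (hJ hx))).1 hx0
    obtain ⟨n, hn⟩ := (hcos y (Ico_subset_Icc_self (hJ hy))).1 hy0
    have e1 : s * (x + 1) < s * (y + 1) := mul_lt_mul_of_pos_left (by linarith) hs
    have e2 : (m : ℝ) < n := lt_of_mul_lt_mul_right (by linarith) hpi.le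
    have e3 : (m : ℝ) + 1 ≤ n := by
      have : m < n := by exact_mod_cast e2
      exact_mod_cast this
    have e4 := mul_le_mul_of_nonneg_right e3 hpi.le
    -- The point of phase (m+1)π, a zero of the sine lying after π/2 + mπ and before π/2 + nπ.
    set z := ((m + 1 : ℤ) * Real.pi - angle B s) / s - 1 with hz
    have hz' : s * (z + 1) + angle B s = (m + 1 : ℤ) * Real.pi := by
      rw [hz]; field_simp; ring
    have hz'' := hz'
    push_cast at hz''
    have e5 : x + 1 < z + 1 := lt_of_mul_lt_mul_left (by linarith) hs.le
    have e6 : z + 1 < y + 1 := lt_of_mul_lt_mul_left (by linarith) hs.le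
    refine ⟨z, ⟨by linarith, by linarith⟩, ?_⟩
    rw [h.eq z ⟨by linarith [(hJ hx).1], by linarith [(hJ hy).2]⟩, hz', Real.sin_int_mul_pi,
      mul_zero]
  split_ifs with ha
  · have h0 := angle_of_neumann ha s
    refine ⟨h.c2, ?_, ?_, hright0, hcount _ subset_rfl fun x i hi hx => ⟨?_, hgridlt x i hi hx⟩,
      hbetween _ subset_rfl⟩
    · rw [hleft', h0, Real.cos_pi_div_two, mul_zero, mul_zero]
    · rw [hleft, h0, Real.sin_pi_div_two]; linarith
    · rw [h0] at hx
      have e1 : 0 ≤ i * Real.pi := by positivity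
      have e2 : 0 ≤ s * (x + 1) := by linarith
      linarith [nonneg_of_mul_nonneg_right e2 hs]
  · have h0 := angle_lt ha s
    refine ⟨h.c2, ?_, hright0,
      hcount _ Ioo_subset_Ico_self fun x i hi hx => ⟨?_, hgridlt x i hi hx⟩,
      hbetween _ Ioo_subset_Ico_self⟩
    · rw [hleft']
      exact mul_pos hc (mul_pos hs
        (Real.cos_pos_of_mem_Ioo ⟨by linarith [hθ.1], h0⟩))
    · have e1 : 0 ≤ i * Real.pi := by positivity
      exact (phase_at_mem (B := B) hs).1.2 (by rw [hx]; linarith)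

/-! ### Localization of the eigenvalues of the multi-point problem -/

theorem EndBC.Regular.sum_lt_α₀ {B : EndBC} (h : B.Regular) {s : ℝ} (hα : 0 < B.α₀)
    (hs : s * B.β₀ ≤ B.α₀) : B.sumα + s * B.sumβ < B.α₀ := by
  have := h.weighted_lt (x := 1) (y := s) hα (by linarith) (by linarith)
  linarith

theorem EndBC.Regular.sum_lt_β₀ {B : EndBC} (h : B.Regular) {s : ℝ} (hβ : 0 < s * B.β₀)
    (hs : B.α₀ ≤ s * B.β₀) : B.sumα + s * B.sumβ < s * B.β₀ := by
  have := h.weighted_lt (x := 1) (y := s) hβ (by linarith) (by linarith)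
  linarith

section Localization

variable {Bm Bp : EndBC} (hBm : Bm.Admissible (-1)) (hα : Bm.α = 0) (hβ : Bm.β = 0)
  (hBp : Bp.Regular)

include hBm hα hβ hBp

/-- If the characteristic function alternates in sign on a grid, is nonzero to the left of the grid
and has at most one zero between consecutive grid points, except possibly the last two, then the
eigenvalues lie between consecutive grid points. -/
theorem exists_isKthEigenvalue_of_grid {g : ℕ → ℝ} {m : ℕ} (h0 : 0 ≤ g 0)
    (hlt : ∀ n ≤ m, g n < g (n + 1))
    (hsign : ∀ n ≤ m + 1, 0 < (-1) ^ n * charFun Bm Bp (g n))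
    (hfirst : ∀ t, 0 ≤ t → t ≤ g 0 → charFun Bm Bp t ≠ 0)
    (huniq : ∀ n < m, ∀ s t, g n < s → s < t → t < g (n + 1) →
      charFun Bm Bp s = 0 → charFun Bm Bp t ≠ 0) :
    ∀ n ≤ m, ∃ z ∈ Ioo (g n) (g (n + 1)), charFun Bm Bp z = 0 ∧
      IsKthEigenvalue Bm Bp n (z ^ 2) := by
  have hopp : ∀ n ≤ m, charFun Bm Bp (g n) * charFun Bm Bp (g (n + 1)) < 0 := by
    intro n hn
    have h1 := mul_pos (hsign n (by omega)) (hsign (n + 1) (by omega))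
    have h2 : (-1) ^ n * charFun Bm Bp (g n) * ((-1) ^ (n + 1) * charFun Bm Bp (g (n + 1))) =
        -(charFun Bm Bp (g n) * charFun Bm Bp (g (n + 1))) := by
      linear_combination (-(charFun Bm Bp (g n) * charFun Bm Bp (g (n + 1)))) * neg_one_pow_sq n
    linarith
  have hnonneg : ∀ n ≤ m, 0 ≤ g n := by
    intro n hn
    induction n with
    | zero => exact h0
    | succ n ih => exact (ih (by omega)).trans (hlt n (by omega)).le
  intro n hn
  obtain ⟨z, hz, hz0, hleast⟩ :=
    exists_least_zero (continuous_charFun Bm Bp) (hlt n hn) (hopp n hn)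
  refine ⟨z, hz, hz0, ?_⟩
  -- The induction carries the leastness of z in its interval. Between the previous least zero and z
  -- there is then no zero: uniqueness rules it out before the grid point, leastness after it.
  induction n generalizing z with
  | zero =>
    refine isKthEigenvalue_zero_of_least hBm hα hβ hBp (h0.trans hz.1.le) hz0 fun t ht htz => ?_
    rcases le_or_gt t (g 0) with h | h
    · exact hfirst t ht h
    · exact hleast t ⟨h.le, htz⟩
  | succ n ih =>
    obtain ⟨y, hy, hy0, hyleast⟩ :=
      exists_least_zero (continuous_charFun Bm Bp) (hlt n (by omega)) (hopp n (by omega))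
    refine isKthEigenvalue_succ_of_least hBm hα hβ hBp (ih (by omega) y hy hy0 hyleast)
      ((hnonneg n (by omega)).trans hy.1.le) (hy.2.trans hz.1) hz0 fun t hyt htz => ?_
    rcases le_or_gt (g (n + 1)) t with h | h
    · exact hleast t ⟨h, htz⟩
    · exact huniq n (by omega) y t hy.1 hyt h hy0

/-- The eigenvalues `λ_k` and `λ_{k+1}` for `k = k_c ≥ 0`. Here `N n` and `D n` are the square roots
of `λ_n^{RN}` and `λ_n^{RD}`, and `e` is a point that separates the two eigenvalues. -/
theorem exists_critical_eigenvalues (hα0 : 0 < Bp.α₀) (hβ0 : 0 < Bp.β₀) {k : ℕ} {N D : ℕ → ℝ}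
    (hN0 : ∀ n, 0 ≤ N n) (hN : ∀ n, phase Bm (N n) = Real.pi / 2 + n * Real.pi)
    (hD : ∀ n, phase Bm (D n) = (n + 1 : ℕ) * Real.pi)
    (hDk : D k * Bp.β₀ ≤ Bp.α₀) (hDk1 : Bp.α₀ ≤ D (k + 1) * Bp.β₀) {e : ℝ}
    (hDe : D k ≤ e) (heN : e ≤ N (k + 1)) (he : Bp.sumα + e * Bp.sumβ < Bp.α₀)
    (hsign : 0 < (-1) ^ (k + 1) * charFun Bm Bp e) :
    ∃ z z', z ∈ Ioo (N k) (N (k + 1)) ∧ z' ∈ Ioo e (D (k + 1)) ∧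
      IsKthEigenvalue Bm Bp k (z ^ 2) ∧ IsKthEigenvalue Bm Bp (k + 1) (z' ^ 2) := by
  have hmono := phase_strictMono hBm
  have hpi := Real.pi_pos
  have hND : ∀ n, N n < D n := fun n => by
    rw [← hmono.lt_iff_lt, hN, hD]; push_cast; linarith
  have hDN : ∀ n, D n < N (n + 1) := fun n => by
    rw [← hmono.lt_iff_lt, hN, hD]; push_cast; linarith
  have hNmono : StrictMono N := strictMono_nat_of_lt_succ fun n => (hND n).trans (hDN n)
  have hsmall : ∀ s, s ≤ D k → s * Bp.β₀ ≤ Bp.α₀ := fun s hs =>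
    (mul_le_mul_of_nonneg_right hs hβ0.le).trans hDk
  -- The grid is N 0, ..., N k, e, D (k + 1). Its interval (N k, e) lies inside (N k, N (k + 1)), so
  -- the uniqueness lemma applies there too.
  set g : ℕ → ℝ := fun n => if n ≤ k then N n else if n = k + 1 then e else D (k + 1) with hg
  have hg1 : ∀ n ≤ k, g n = N n := fun n hn => by simp [hg, hn]
  have hg2 : g (k + 1) = e := by simp [hg]
  have hg3 : g (k + 2) = D (k + 1) := by simp [hg]
  have hgle : ∀ n ≤ k, g (n + 1) ≤ N (n + 1) ∧ g (n + 1) ≤ e ∧ N n < g (n + 1) := by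
    intro n hn
    rcases hn.lt_or_eq with h | h
    · rw [hg1 (n + 1) h]
      exact ⟨le_rfl, (hNmono.monotone h).trans ((hND k).le.trans hDe), hNmono (by omega)⟩
    · rw [h, hg2]
      exact ⟨heN, le_rfl, (hND k).trans_le hDe⟩
  have key := exists_isKthEigenvalue_of_grid hBm hα hβ hBp (g := g) (m := k + 1) ?_ ?_ ?_ ?_ ?_
  · obtain ⟨z, hz, -, hzk⟩ := key k (by omega)
    obtain ⟨z', hz', -, hzk'⟩ := key (k + 1) le_rfl
    rw [hg1 k le_rfl, hg2] at hz
    rw [hg2, hg3] at hz'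
    exact ⟨z, z', ⟨hz.1, hz.2.trans_le heN⟩, hz', hzk, hzk'⟩
  · rw [hg1 0 (Nat.zero_le k)]; exact hN0 0
  · intro n hn
    rcases Nat.lt_or_ge k n with h | h
    · obtain rfl : n = k + 1 := by omega
      rw [hg2, hg3]
      exact heN.trans_lt (hND _)
    · rw [hg1 n h]
      exact (hgle n h).2.2
  · intro n hn
    rcases Nat.lt_or_ge k n with h | h
    · rcases (show n = k + 1 ∨ n = k + 2 by omega) with rfl | rfl
      · rwa [hg2]
      · rw [hg3]
        have hpos : 0 < D (k + 1) := (hN0 _).trans_lt (hND _)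
        exact charFun_sign_dirichlet hBm hpos (hD (k + 1))
          (hBp.sum_lt_β₀ (mul_pos hpos hβ0) hDk1)
    · rw [hg1 n h]
      exact charFun_sign_neumann hBm (hN0 n) (hN n)
        (hBp.sum_lt_α₀ hα0 (hsmall _ ((hNmono.monotone h).trans (hND k).le)))
  · intro t ht htg
    rw [hg1 0 (Nat.zero_le k)] at htg
    refine charFun_ne_zero_of_phase_le hBm hBp ht ?_ hα0
      (hsmall _ (htg.trans ((hNmono.monotone (Nat.zero_le k)).trans (hND k).le)))
    simpa [hN] using hmono.monotone htg
  · intro n hn s t hs hst ht hs0 ht0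
    have hnk : n ≤ k := by omega
    rw [hg1 n hnk] at hs
    obtain ⟨h1, h2, -⟩ := hgle n hnk
    refine charFun_zero_unique hBm hBp (n := n) ?_ hst ?_ ((hN0 n).trans_lt hs) ?_ ?_ hs0 ht0
    · rw [← hN]; exact hmono hs
    · rw [← hN]; exact hmono (ht.trans_le h1)
    · have := mul_le_mul_of_nonneg_right (ht.le.trans h2) Bp.sumβ_nonneg
      linarith
    · intro r hr
      rw [← hD, hmono.le_iff_le] at hr
      refine hsmall r (hr.trans (hmono.le_iff_le.1 ?_))
      rw [hD, hD]
      have : ((n + 1 : ℕ) : ℝ) ≤ (k + 1 : ℕ) := by exact_mod_cast Nat.succ_le_succ hnk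
      exact mul_le_mul_of_nonneg_right this hpi.le

/-- The least eigenvalue for `k_c = -1`. -/
theorem exists_least_eigenvalue (h : 0 < Bm.α₀ + Bp.α₀) (hβ0 : 0 < Bp.β₀) {d : ℝ} (hd : 0 < d)
    (hphase : phase Bm d = Real.pi) (hd' : Bp.α₀ ≤ d * Bp.β₀) :
    ∃ z ∈ Ioo 0 d, IsKthEigenvalue Bm Bp 0 (z ^ 2) := by
  have h0 := charFun_zero_pos hBm hBp h
  have key := exists_isKthEigenvalue_of_grid hBm hα hβ hBp (g := fun n => if n = 0 then 0 else d)
    (m := 0) ?_ ?_ ?_ ?_ ?_ 0 le_rfl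
  · obtain ⟨z, hz, -, hz'⟩ := key
    exact ⟨z, by simpa using hz, hz'⟩
  · simp
  · intro n hn
    obtain rfl : n = 0 := by omega
    simpa using hd
  · intro n hn
    rcases (show n = 0 ∨ n = 1 by omega) with rfl | rfl
    · simpa using h0
    · exact charFun_sign_dirichlet hBm (n := 1) hd (by simpa using hphase)
        (hBp.sum_lt_β₀ (mul_pos hd hβ0) hd')
  · intro t ht ht'
    obtain rfl : t = 0 := le_antisymm (by simpa using ht') ht
    exact h0.ne'
  · intro n hn
    omega

end Localization

theorem isKthEigenvalue_zero_zero {Bm Bp : EndBC} (hBm : Bm.Admissible (-1)) (hα : Bm.α = 0)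
    (hβ : Bm.β = 0) (hBp : Bp.Regular) (h : Bm.α₀ = 0) (h' : Bp.α₀ = 0) :
    IsKthEigenvalue Bm Bp 0 0 := by
  have hA : ∀ i, Bp.α i = 0 := fun i => by
    have h1 : Bp.sumα = 0 := hBp.lin.1.1 h'
    have := (Finset.sum_eq_zero_iff_of_nonneg fun i _ => abs_nonneg (Bp.α i)).1 h1 i
      (Finset.mem_univ i)
    exact abs_eq_zero.1 this
  have h0 : charFun Bm Bp 0 = 0 := by
    simp [charFun, EndBC.defect, wave, waveDeriv, robin, robinDeriv, h, h', hA]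
  simpa using isKthEigenvalue_zero_of_least hBm hα hβ hBp le_rfl h0 fun t ht ht' =>
    absurd ht' (not_lt.2 ht)

theorem EndBC.J_eq {B : EndBC} (h : B.β₀ ≠ 0) : B.J = (((B.α₀ / B.β₀) ^ 2 : ℝ) : EReal) := by
  simp [EndBC.J, h]

theorem EndBC.β₀_ne_zero_of_J_ne_top {B : EndBC} (h : B.J ≠ ⊤) : B.β₀ ≠ 0 := fun h0 =>
  h (by simp [EndBC.J, h0])

end MultiPoint

end

/-! ### The theorem on the eigenvalues near the critical index -/

open MultiPoint

theorem mainTheorem6 (Bm Bp : MultiPoint.EndBC)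
    (hBm : Bm.Admissible (-1)) (hBp : Bp.Admissible 1)
    (hαm : Bm.α = 0) (hβm : Bm.β = 0)
    (hlin : Bp.LinCond)
    (kc : ℤ) (hkc : MultiPoint.IsCriticalIndex Bm Bp kc)
    (hab :
      (((MultiPoint.eigRD Bm kc : EReal) < Bp.J ∧
          Bp.J < (MultiPoint.eigRN Bm (kc + 1) : EReal)) ∧
        (Bp.ValueNonzeroCond (MultiPoint.eigRD Bm kc) ∨
          Bp.DerivNonzeroCond (MultiPoint.eigRN Bm (kc + 1)))) ∨
      ((MultiPoint.eigRN Bm (kc + 1) : EReal) ≤ Bp.J ∧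
        Bp.J ≤ (MultiPoint.eigRD Bm (kc + 1) : EReal))) :
    (∀ k : ℕ, (k : ℤ) = kc →
      MultiPoint.IsKthEigenvalue Bm Bp k (MultiPoint.eigenvalue Bm Bp k) ∧
      (∀ ψ, MultiPoint.IsEigenfunction Bm Bp (MultiPoint.eigenvalue Bm Bp k) ψ →
        ψ ∈ MultiPoint.nodalT Bm (k + 1)) ∧
      MultiPoint.eigRN Bm k < MultiPoint.eigenvalue Bm Bp k ∧
      MultiPoint.eigenvalue Bm Bp k < MultiPoint.eigRN Bm (k + 1)) ∧
    (∀ k : ℕ, (k : ℤ) = kc + 1 →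
      MultiPoint.IsKthEigenvalue Bm Bp k (MultiPoint.eigenvalue Bm Bp k) ∧
      (∀ ψ, MultiPoint.IsEigenfunction Bm Bp (MultiPoint.eigenvalue Bm Bp k) ψ →
        ψ ∈ MultiPoint.nodalS Bm k) ∧
      (0 < Bm.α₀ + Bp.α₀ → MultiPoint.eigRD Bm (k - 1) < MultiPoint.eigenvalue Bm Bp k) ∧
      (Bm.α₀ + Bp.α₀ = 0 → MultiPoint.eigenvalue Bm Bp k = 0) ∧
      MultiPoint.eigenvalue Bm Bp k < MultiPoint.eigRD Bm k) := by
  have hreg := hBp.regular hlin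
  have hpi := Real.pi_pos
  have hmono := phase_strictMono hBm
  have hαn := hreg.α₀_nonneg
  have hcrit : -1 ≤ kc := hkc.1
  have hJle : Bp.J ≤ (eigRD Bm (kc + 1) : EReal) ∨ Bp.J = 0 := hkc.2.imp (·.2) (·.1)
  have hβ0 : 0 < Bp.β₀ := by
    refine lt_of_le_of_ne hreg.β₀_nonneg (Ne.symm (EndBC.β₀_ne_zero_of_J_ne_top ?_))
    rcases hJle with h | h
    · exact (h.trans_lt (EReal.coe_lt_top _)).ne
    · rw [h]; exact EReal.zero_ne_top
  have hJ := EndBC.J_eq hβ0.ne'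
  have hjn : 0 ≤ Bp.α₀ / Bp.β₀ := div_nonneg hαn hβ0.le
  have hN' : ∀ n : ℕ, ∃ s, 0 ≤ s ∧ phase Bm s = Real.pi / 2 + n * Real.pi := fun n =>
    exists_phase_eq hBm ((angle_zero_le hBm).trans (le_add_of_nonneg_right (by positivity)))
  have hD' : ∀ n : ℕ, ∃ s, 0 ≤ s ∧ phase Bm s = (n + 1 : ℕ) * Real.pi := fun n =>
    exists_phase_eq hBm ((angle_zero_le hBm).trans (by
      have : 0 ≤ n * Real.pi := by positivity
      push_cast
      linarith))
  choose N hN0 hN using hN'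
  choose D hD0 hD using hD'
  have hRN : ∀ n : ℕ, eigRN Bm n = N n ^ 2 := fun n => eigRN_eq hBm hαm hβm (hN0 n) (hN n)
  have hRD : ∀ n : ℕ, eigRD Bm n = D n ^ 2 := fun n => eigRD_eq hBm hαm hβm (hD0 n) (hD n)
  have hND : ∀ n, N n < D n := fun n => by
    rw [← hmono.lt_iff_lt, hN, hD]; push_cast; linarith
  have hDN : ∀ n, D n < N (n + 1) := fun n => by
    rw [← hmono.lt_iff_lt, hN, hD]; push_cast; linarith
  have hDpos : ∀ n, 0 < D n := fun n => (hN0 n).trans_lt (hND n)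
  have hle : ∀ {s : ℝ}, 0 ≤ s → (Bp.J ≤ ((s ^ 2 : ℝ) : EReal) ↔ Bp.α₀ ≤ s * Bp.β₀) := by
    intro s hs
    rw [hJ, EReal.coe_le_coe_iff, pow_le_pow_iff_left₀ hjn hs two_ne_zero, div_le_iff₀ hβ0]
  have hge : ∀ {s : ℝ}, 0 ≤ s → (((s ^ 2 : ℝ) : EReal) ≤ Bp.J ↔ s * Bp.β₀ ≤ Bp.α₀) := by
    intro s hs
    rw [hJ, EReal.coe_le_coe_iff, pow_le_pow_iff_left₀ hs hjn two_ne_zero, le_div_iff₀ hβ0]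
  rcases hcrit.eq_or_lt with rfl | hkc0
  · refine ⟨fun k hk => by omega, fun k hk => ?_⟩
    obtain rfl : k = 0 := by omega
    have hD1 : Bp.α₀ ≤ D 0 * Bp.β₀ := by
      rw [← hle (hD0 0), ← hRD]
      rcases hJle with h | h
      · simpa using h
      · rw [h, hRD]
        exact_mod_cast sq_nonneg (D 0)
    rw [show ((0 : ℕ) : ℤ) - 1 = -1 by norm_num, eigRD_neg Bm (by norm_num), hRD]
    -- If both α₀ vanish, constants are eigenfunctions for λ = 0; otherwise the characteristic
    -- function is positive at 0 and a positive eigenvalue is found below D 0 squared.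
    rcases (add_nonneg hBm.left_pos.1 hαn).eq_or_lt with h0 | h0
    · have ha : Bm.α₀ = 0 := by linarith [hBm.left_pos.1]
      have hk0 := isKthEigenvalue_zero_zero hBm hαm hβm hreg ha (by linarith)
      rw [hk0.eigenvalue_eq]
      refine ⟨hk0, fun ψ hψ => ?_, fun h => absurd h0 h.ne, fun _ => rfl, pow_pos (hDpos 0) 2⟩
      rw [show (0 : ℝ) = 0 ^ 2 by norm_num] at hψ
      obtain ⟨c, hc, hs⟩ := hψ.exists_isSine hBm hαm hβm (Or.inr ⟨rfl, ha⟩)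
      exact hs.mem_nodalS_zero_of_const hBm ha hc
    · have hphase : phase Bm (D 0) = Real.pi := by simpa using hD 0
      obtain ⟨z, hz, hzk⟩ := exists_least_eigenvalue hBm hαm hβm hreg h0 hβ0 (hDpos 0) hphase hD1
      rw [hzk.eigenvalue_eq]
      refine ⟨hzk, fun ψ hψ => ?_, fun _ => pow_pos hz.1 2, fun h => absurd h.symm h0.ne,
        pow_lt_pow_left₀ hz.2 hz.1.le two_ne_zero⟩
      obtain ⟨c, hc, hs⟩ := hψ.exists_isSine hBm hαm hβm (Or.inl hz.1)
      refine hs.mem_nodalS hBm hc hz.1 ?_ ?_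
      · simpa using phase_pos hBm hz.1
      · rw [← hD]; exact hmono hz.2
  · lift kc to ℕ using by omega
    have hkc1 : ((kc : ℤ) + 1) = ((kc + 1 : ℕ) : ℤ) := by push_cast; rfl
    have hcr := hkc.2.resolve_right fun h => by omega
    rw [hkc1, hRD, hRD] at hcr
    rw [hkc1, hRD, hRD, hRN] at hab
    have hDk1 := (hle (hD0 _)).1 hcr.2
    have hDk : D kc * Bp.β₀ < Bp.α₀ := by
      rw [← not_le, ← hle (hD0 _), not_le]
      exact hcr.1
    have hα0 : 0 < Bp.α₀ := (mul_pos (hDpos kc) hβ0).trans hDk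
    have hcase2 : ∀ h : Bp.sumα + N (kc + 1) * Bp.sumβ < Bp.α₀,
        ∃ e, D kc ≤ e ∧ e ≤ N (kc + 1) ∧ Bp.sumα + e * Bp.sumβ < Bp.α₀ ∧
          0 < (-1) ^ (kc + 1) * charFun Bm Bp e := fun h =>
      ⟨N (kc + 1), (hDN kc).le, le_rfl, h, charFun_sign_neumann hBm (hN0 _) (hN _) h⟩
    -- The separating point is `D kc` in case (a)(i) and `N (kc + 1)` in cases (a)(ii) and (b). In
    -- (b) the sign there follows from N (kc + 1) β₀ ≤ α₀ and the linear condition.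
    obtain ⟨e, hDe, heN, he, hsign⟩ : ∃ e, D kc ≤ e ∧ e ≤ N (kc + 1) ∧
        Bp.sumα + e * Bp.sumβ < Bp.α₀ ∧ 0 < (-1) ^ (kc + 1) * charFun Bm Bp e := by
      rcases hab with ⟨-, h | h⟩ | h
      · refine ⟨D kc, le_rfl, (hDN kc).le, hreg.sum_lt_α₀ hα0 hDk.le,
          charFun_sign_dirichlet hBm (hDpos kc) (hD kc) ?_⟩
        have h2 := h.2
        rw [Real.sqrt_sq (hD0 kc)] at h2
        have h3 := mul_lt_mul_of_pos_left h2 (hDpos kc)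
        have h4 : D kc * (1 / D kc * Bp.sumα + Bp.sumβ) = Bp.sumα + D kc * Bp.sumβ := by
          have := (hDpos kc).ne'
          field_simp
        linarith
      · refine hcase2 ?_
        have h2 : Bp.α₀ > _ := h
        rwa [Real.sqrt_sq (hN0 _)] at h2
      · exact hcase2 (hreg.sum_lt_α₀ hα0 ((hge (hN0 _)).1 h.1))
    obtain ⟨z, z', hz, hz', hzk, hzk'⟩ := exists_critical_eigenvalues hBm hαm hβm hreg hα0 hβ0
      hN0 hN hD hDk.le hDk1 hDe heN he hsign
    have hz0 : 0 < z := (hN0 kc).trans_lt hz.1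
    have hDz : D kc < z' := hDe.trans_lt hz'.1
    have hz0' : 0 < z' := (hDpos kc).trans hDz
    constructor
    · intro k hk
      obtain rfl : k = kc := by omega
      rw [hzk.eigenvalue_eq, hkc1, hRN, hRN]
      refine ⟨hzk, fun ψ hψ => ?_, pow_lt_pow_left₀ hz.1 (hN0 k) two_ne_zero,
        pow_lt_pow_left₀ hz.2 hz0.le two_ne_zero⟩
      obtain ⟨c, hc, hs⟩ := hψ.exists_isSine hBm hαm hβm (Or.inl hz0)
      refine hs.mem_nodalT hBm hc hz0 ?_ ?_
      · rw [← hN]; exact hmono hz.1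
      · rw [← hN]; exact hmono hz.2
    · intro k hk
      obtain rfl : k = kc + 1 := by omega
      rw [show ((kc + 1 : ℕ) : ℤ) - 1 = kc by push_cast; ring, hzk'.eigenvalue_eq, hRD, hRD]
      refine ⟨hzk', fun ψ hψ => ?_, fun _ => pow_lt_pow_left₀ hDz (hD0 kc) two_ne_zero,
        fun h => ?_, pow_lt_pow_left₀ hz'.2 hz0'.le two_ne_zero⟩
      · obtain ⟨c, hc, hs⟩ := hψ.exists_isSine hBm hαm hβm (Or.inl hz0')
        refine hs.mem_nodalS hBm hc hz0' ?_ ?_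
        · rw [← hD]; exact hmono hDz
        · rw [← hD]; exact hmono hz'.2
      · linarith [hBm.left_pos.1]
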